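/- **Setting.** Let $V$ be a smooth manifold of dimension $2n+1$ without boundary, not necessarily closed, with a contact form $\lambda$ whose Reeb flow $e_t$ is 1-periodic ($e_1=\mathrm{id}$). Contactomorphisms are diffeomorphisms $f$ with $f^*\lambda=\rho\lambda$, $\rho>0$. Let $\mathcal G_c$ be the identity component of the group of compactly supported contactomorphisms, $\mathcal G_e=\{e_t\circ\phi : t\in\mathbb R,\ \phi\in\mathcal G_c\}$, and let $\widetilde{\mathcal G}_e$ be the universal cover of $\mathcal G_e$: homotopy classes with fixed end points of smooth paths $\{f_t\}_{t\in[0,1]}$ in $\mathcal G_e$ with $f_0=\mathrm{id}$. The classes containing a path in $\mathcal G_c$ form the subgroup $\widetilde{\mathcal G}_c$ (the universal cover of $\mathcal G_c$). Let $\Pi$ be the image of $\pi_1(\mathcal G_c,\mathrm{id})$ in $\pi_1(\mathcal G_e,\mathrm{id})$. Let $SV=(V\times\mathbb R_+,d(s\lambda))$ be the symplectization, and let $\overline f(x,s)=(f(x),s/\rho(x))$ be the lift of $f$ to $SV$. The contact Hamiltonian of a contact isotopy $f_t$ is the function on $SV$ $$F_t(x,s)=s\,\lambda_x(X_t(x)),\qquad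 X_t=\tfrac{d f_t}{dt}\circ f_t^{-1},$$ which is the $\mathbb R_+$-equivariant Hamiltonian generating $\overline f_t$; that of $e_{ct}$ is $cs$. For $f,g\in\widetilde{\mathcal G}_e$ write $f\succeq\mathrm{id}$ if some path in the class $f$ has a non-negative contact Hamiltonian, and $f\succeq g$ if $fg^{-1}\succeq\mathrm{id}$. For $m\in\mathbb Z$ let $e^m\in\widetilde{\mathcal G}_e$ be the class of $\{e_{mt}\}_{t\in[0,1]}$, and put $$\nu_+(f)=\min\{m\in\mathbb Z: e^m\succeq f\},\quad \nu_-(f)=\max\{m\in\mathbb Z: f\succeq e^m\},\quad \nu(f)=\max(|\nu_+(f)|,|\nu_-(f)|).$$ For $f'\in\mathcal G_c$ put $\nu_*(f')=\inf\nu(f)$, the infimum being over all lifts $f\in\widetilde{\mathcal G}_c$ of $f'$. For a smooth loop $\varphi=\{\phi_t\}_{t\in S^1}$ in $\mathcal G_e$, $S^1=\mathbb R/\mathbb Z$, $\phi_0=\mathrm{id}$, with contact Hamiltonian $\Phi_t$, the suspension is the map of $SV\times T^*S^1$ $$\Sigma_\varphi(z,r,t)=(\overline\phi_t z,\ r-\Phi_t(\overline\phi_t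 z),\ t).$$ A pair of subsets $A,B\subset SV$ with $B$ compact has the *strong stable intersection property* if $\Sigma_\varphi(A\times S^1)\cap(B\times S^1)\neq\emptyset$ for every such loop $\varphi$ representing an element of $\Pi$, where $S^1\subset T^*S^1$ is the zero section. **Theorem 2.6.** Suppose that $(A,B)$ has the strong stable intersection property and that $B$ is invariant under the flow $\overline e_t$. Let $c>0$, and assume that $f\in\widetilde{\mathcal G}_c$ is generated by a contact Hamiltonian $F_t$, $t\in S^1$ (1-periodic in time), which satisfies $F_t>cs$ on $B$ for all $t\in S^1$. Let $f'\in\mathcal G_c$ be the time-one map of the corresponding contact isotopy $f_t$. Then $\nu_*(f')\ge c$. -/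

import Mathlib

open Set Topology
open scoped Manifold ContDiff

/-- The model space `ℝ^{2n+1}`. -/
abbrev ContactModel (n : ℕ) : Type := EuclideanSpace ℝ (Fin (2 * n + 1))

noncomputable section

namespace ContactGeometry

variable {n : ℕ} {V : Type*} [TopologicalSpace V] [ChartedSpace (ContactModel n) V]

/-- The expression of a 1-form `α` in the preferred chart at `x₀`, i.e. its pull-back under the
inverse of the chart. -/
def chartForm (α : ∀ x : V, TangentSpace (𝓡 (2 * n + 1)) x →L[ℝ] ℝ) (x₀ : V)
    (y : ContactModel n) : ContactModel n →L[ℝ] ℝ :=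
  (α ((extChartAt (𝓡 (2 * n + 1)) x₀).symm y)).comp
    (mfderiv 𝓘(ℝ, ContactModel n) (𝓡 (2 * n + 1)) (extChartAt (𝓡 (2 * n + 1)) x₀).symm y)

/-- The exterior derivative `dα_x (v, w)` of a 1-form. It is computed in the preferred chart at
`x`, whose differential at `x` is Mathlib's identification of `T_x V` with the model space. -/
def dForm (α : ∀ x : V, TangentSpace (𝓡 (2 * n + 1)) x →L[ℝ] ℝ) (x : V)
    (v w : TangentSpace (𝓡 (2 * n + 1)) x) : ℝ :=
  fderiv ℝ (chartForm α x) (extChartAt (𝓡 (2 * n + 1)) x x) v w -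
    fderiv ℝ (chartForm α x) (extChartAt (𝓡 (2 * n + 1)) x x) w v

theorem contMDiffAt_chart_symm (x : V) :
    ContMDiffAt 𝓘(ℝ, ContactModel n) (𝓡 (2 * n + 1)) ∞ (extChartAt (𝓡 (2 * n + 1)) x).symm
      (extChartAt (𝓡 (2 * n + 1)) x x) := by
  have := contMDiffWithinAt_extChartAt_symm_range_self (I := 𝓡 (2 * n + 1)) (n := ∞) x
  simpa [ContMDiffAt] using this

theorem hasMFDerivAt_of_eq {f : V → ContactModel n} {x x' : V} (h : x' = x)
    {L : ContactModel n →L[ℝ] ContactModel n}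
    (hf : HasMFDerivAt (𝓡 (2 * n + 1)) 𝓘(ℝ, ContactModel n) f x L) :
    HasMFDerivAt (𝓡 (2 * n + 1)) 𝓘(ℝ, ContactModel n) f x' L := by
  subst h
  exact hf

theorem pullback_antisymm {P E : Type*} [NormedAddCommGroup P] [NormedSpace ℝ P]
    [NormedAddCommGroup E] [NormedSpace ℝ E] {a : E → E →L[ℝ] ℝ} {γ : P → E} {p : P}
    (ha : DifferentiableAt ℝ a (γ p)) (hγ : ContDiffAt ℝ 2 γ p) :
    ∃ B : P →L[ℝ] P →L[ℝ] ℝ, HasFDerivAt (fun q => (a (γ q)).comp (fderiv ℝ γ q)) B p ∧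
      ∀ u w, B u w - B w u = fderiv ℝ a (γ p) (fderiv ℝ γ p u) (fderiv ℝ γ p w) -
        fderiv ℝ a (γ p) (fderiv ℝ γ p w) (fderiv ℝ γ p u) := by
  have h1 : HasFDerivAt γ (fderiv ℝ γ p) p := (hγ.differentiableAt (by norm_num)).hasFDerivAt
  have h2 : HasFDerivAt (fun q => a (γ q)) ((fderiv ℝ a (γ p)).comp (fderiv ℝ γ p)) p :=
    ha.hasFDerivAt.comp p h1
  have h3 : HasFDerivAt (fderiv ℝ γ) (fderiv ℝ (fderiv ℝ γ) p) p :=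
    ((hγ.fderiv_right (m := 1) (by norm_num)).differentiableAt (by norm_num)).hasFDerivAt
  refine ⟨_, h2.clm_comp h3, fun u w => ?_⟩
  have hs : IsSymmSndFDerivAt ℝ γ p := hγ.isSymmSndFDerivAt (by simp)
  have := hs.eq u w
  simp [this]

variable [IsManifold (𝓡 (2 * n + 1)) ∞ V]

variable (n V) in
/-- A contact form `α` on a `(2n+1)`-manifold `V`: a smooth 1-form such that `dα` is
nondegenerate on the hyperplane field `ξ = ker α` (equivalently `α ∧ (dα)^n` vanishes nowhere).
The co-oriented contact structure is `ξ`. -/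
structure ContactForm where
  form : ∀ x : V, TangentSpace (𝓡 (2 * n + 1)) x →L[ℝ] ℝ
  smooth : ContMDiff (𝓡 (2 * n + 1)) ((𝓡 (2 * n + 1)).prod 𝓘(ℝ, ContactModel n →L[ℝ] ℝ)) ∞
    (fun x : V => Bundle.TotalSpace.mk' (ContactModel n →L[ℝ] ℝ)
      (E := fun x : V => TangentSpace (𝓡 (2 * n + 1)) x →L[ℝ] ℝ) x (form x))
  nondegenerate : ∀ (x : V) (v : TangentSpace (𝓡 (2 * n + 1)) x), form x v = 0 →
    (∀ w : TangentSpace (𝓡 (2 * n + 1)) x, form x w = 0 → dForm form x v w = 0) → v = 0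

/-- The Reeb vector field `R` of `α` (`α(R) = 1`, `dα(R, ·) = 0`) together with its flow `e_t`,
which is an action of the circle `ℝ/ℤ`: `e_1 = id`. -/
structure ReebCircleAction (α : ContactForm n V) where
  reeb : ∀ x : V, TangentSpace (𝓡 (2 * n + 1)) x
  form_reeb : ∀ x, α.form x (reeb x) = 1
  dForm_reeb : ∀ x (v : TangentSpace (𝓡 (2 * n + 1)) x), dForm α.form x (reeb x) v = 0
  flow : ℝ → V → V
  smooth : ContMDiff (𝓘(ℝ, ℝ).prod (𝓡 (2 * n + 1))) (𝓡 (2 * n + 1)) ∞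
    (fun p : ℝ × V => flow p.1 p.2)
  flow_zero : ∀ x, flow 0 x = x
  flow_add : ∀ s t x, flow (s + t) x = flow s (flow t x)
  flow_one : ∀ x, flow 1 x = x
  integral : ∀ x, IsMIntegralCurve (I := 𝓡 (2 * n + 1)) (fun t => flow t x) reeb

theorem chartForm_contDiffAt (α : ContactForm n V) (x : V) :
    ContDiffAt ℝ ∞ (chartForm α.form x) (extChartAt (𝓡 (2 * n + 1)) x x) := by
  have h2 := ((contMDiffAt_hom_bundle _).1 (α.smooth x)).2
  have h3 : ContMDiffAt 𝓘(ℝ, ContactModel n) (𝓡 (2 * n + 1)) ∞ (extChartAt (𝓡 (2 * n + 1)) x).symm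
     (extChartAt (𝓡 (2 * n + 1)) x x) := by
    have := contMDiffWithinAt_extChartAt_symm_range_self (I := 𝓡 (2 * n + 1)) (n := ∞) x
    simpa [ContMDiffAt] using this
  have h4 := ContMDiffAt.comp_of_eq h2 h3 (by simp)
  rw [← contMDiffAt_iff_contDiffAt]
  refine h4.congr_of_eventuallyEq ?_
  have : (extChartAt (𝓡 (2 * n + 1)) x).target ∈ 𝓝 (extChartAt (𝓡 (2 * n + 1)) x x) :=
    extChartAt_target_mem_nhds x
  filter_upwards [this] with y hy
  have hs : (extChartAt (𝓡 (2 * n + 1)) x).symm y ∈ (chartAt (ContactModel n) x).source := by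
    simpa using (extChartAt (𝓡 (2 * n + 1)) x).map_target hy
  simp only [Function.comp_apply, ContinuousLinearMap.inCoordinates, chartForm]
  rw [TangentBundle.symmL_trivializationAt hs, (extChartAt (𝓡 (2 * n + 1)) x).right_inv hy]
  ext v
  simp [mfderivWithin_univ]

theorem chartForm_apply (α : ContactForm n V) (x₀ x : V)
    (hx : x ∈ (extChartAt (𝓡 (2 * n + 1)) x₀).source) (v : TangentSpace (𝓡 (2 * n + 1)) x) :
    chartForm α.form x₀ (extChartAt (𝓡 (2 * n + 1)) x₀ x)
      (mfderiv (𝓡 (2 * n + 1)) 𝓘(ℝ, ContactModel n) (extChartAt (𝓡 (2 * n + 1)) x₀) x v) =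
      α.form x v := by
  have h := mfderivWithin_extChartAt_symm_comp_mfderiv_extChartAt' (I := 𝓡 (2 * n + 1)) hx
  have h1 := congrArg (fun L => L v) h
  simp only [ContinuousLinearMap.comp_apply, ModelWithCorners.range_eq_univ,
    mfderivWithin_univ] at h1
  have key : ∀ (y : V) (w : ContactModel n), y = x → w = v → α.form y w = α.form x v := by
    rintro _ _ rfl rfl
    rfl
  exact key _ _ ((extChartAt (𝓡 (2 * n + 1)) x₀).left_inv hx) h1

/-- A case of Cartan's formula: if `α(∂_t g_t)` is constant at time `t₀`, then
`d/dt α(dg_t v) = dα(∂_t g_t, dg_t v)` at `t₀`. -/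
theorem hasDerivAt_pullback (α : ContactForm n V) (g : ℝ → V → V)
    (hg : ContMDiff (𝓘(ℝ, ℝ).prod (𝓡 (2 * n + 1))) (𝓡 (2 * n + 1)) ∞
      (fun p : ℝ × V => g p.1 p.2)) (t₀ : ℝ) (x : V) (v : TangentSpace (𝓡 (2 * n + 1)) x)
    (c : ℝ) (hc : ∀ y, α.form (g t₀ y)
      (mfderiv 𝓘(ℝ, ℝ) (𝓡 (2 * n + 1)) (fun t => g t y) t₀ (1 : ℝ)) = c) :
    HasDerivAt (fun t => α.form (g t x) (mfderiv (𝓡 (2 * n + 1)) (𝓡 (2 * n + 1)) (g t) x v))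
      (dForm α.form (g t₀ x)
        (mfderiv 𝓘(ℝ, ℝ) (𝓡 (2 * n + 1)) (fun t => g t x) t₀ (1 : ℝ))
        (mfderiv (𝓡 (2 * n + 1)) (𝓡 (2 * n + 1)) (g t₀) x v)) t₀ := by
  set φ := extChartAt (𝓡 (2 * n + 1)) x with hφ
  set ψ := extChartAt (𝓡 (2 * n + 1)) (g t₀ x) with hψ
  set γ : ℝ × ContactModel n → ContactModel n := fun p => ψ (g p.1 (φ.symm p.2)) with hγd
  set p₀ : ℝ × ContactModel n := (t₀, φ x) with hp₀
  have hφs : ContMDiffAt 𝓘(ℝ, ContactModel n) (𝓡 (2 * n + 1)) ∞ φ.symm (φ x) :=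
    contMDiffAt_chart_symm x
  have hx : φ.symm (φ x) = x := extChartAt_to_inv x
  have hGs : ContMDiffAt (𝓘(ℝ, ℝ).prod 𝓘(ℝ, ContactModel n)) (𝓡 (2 * n + 1)) ∞
      (fun p : ℝ × ContactModel n => g p.1 (φ.symm p.2)) p₀ :=
    ContMDiffAt.comp (I' := 𝓘(ℝ, ℝ).prod (𝓡 (2 * n + 1))) p₀ (hg _)
      (contMDiffAt_fst.prodMk (ContMDiffAt.comp p₀ hφs contMDiffAt_snd))
  have hγm : ContMDiffAt (𝓘(ℝ, ℝ).prod 𝓘(ℝ, ContactModel n)) 𝓘(ℝ, ContactModel n) ∞ γ p₀ := by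
    refine ContMDiffAt.comp_of_eq (contMDiffAt_extChartAt (x := g t₀ x)) hGs (by simp [p₀, hx])
  have hγ : ContDiffAt ℝ ∞ γ p₀ := by
    rw [← contMDiffAt_iff_contDiffAt]
    rwa [modelWithCornersSelf_prod, ← chartedSpaceSelf_prod]
  have hγ0 : γ p₀ = ψ (g t₀ x) := by simp [γ, p₀, hx]
  have ha : DifferentiableAt ℝ (chartForm α.form (g t₀ x)) (γ p₀) := by
    rw [hγ0]
    exact (chartForm_contDiffAt α (g t₀ x)).differentiableAt (by simp)
  obtain ⟨B, hB, hBs⟩ := pullback_antisymm ha (hγ.of_le ENat.LEInfty.out)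
  set β : ℝ × ContactModel n → ℝ × ContactModel n →L[ℝ] ℝ :=
    fun q => (chartForm α.form (g t₀ x) (γ q)).comp (fderiv ℝ γ q) with hβ
  -- the time direction of the pulled back form is constant
  have hγdiff : ∀ᶠ q in 𝓝 p₀, DifferentiableAt ℝ γ q :=
    ((hγ.of_le (m := 1) (by exact_mod_cast le_top)).eventually (by simp)).mono
      fun q hq => hq.differentiableAt (by simp)
  have hGc : ContinuousAt (fun q : ℝ × ContactModel n => g q.1 (φ.symm q.2)) p₀ :=
    hGs.continuousAt
  have hsrc : ∀ᶠ q in 𝓝 p₀, g q.1 (φ.symm q.2) ∈ ψ.source := by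
    refine hGc.eventually_mem ?_
    simp only [p₀, hx]
    exact extChartAt_source_mem_nhds (g t₀ x)
  have hgm : ∀ t, MDifferentiable (𝓡 (2 * n + 1)) (𝓡 (2 * n + 1)) (g t) := fun t =>
    (hg.comp (contMDiff_const.prodMk contMDiff_id)).mdifferentiable (by simp)
  have hgt : ∀ y, MDifferentiable 𝓘(ℝ, ℝ) (𝓡 (2 * n + 1)) (fun t => g t y) := fun y =>
    (hg.comp (contMDiff_id.prodMk contMDiff_const)).mdifferentiable (by simp)
  have hψd : ∀ y ∈ ψ.source, MDifferentiableAt (𝓡 (2 * n + 1)) 𝓘(ℝ, ContactModel n) ψ y :=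
    fun y hy => mdifferentiableAt_extChartAt (by simpa [hψ] using hy)
  have h1 : ∀ᶠ q in 𝓝 p₀, fderiv ℝ γ q (1, 0) =
      mfderiv (𝓡 (2 * n + 1)) 𝓘(ℝ, ContactModel n) ψ (g q.1 (φ.symm q.2))
        (mfderiv 𝓘(ℝ, ℝ) (𝓡 (2 * n + 1)) (fun t => g t (φ.symm q.2)) q.1 (1 : ℝ)) := by
    filter_upwards [hγdiff, hsrc] with q hq hs
    have e1 : HasFDerivAt (fun t : ℝ => γ (t, q.2))
        ((fderiv ℝ γ q).comp (ContinuousLinearMap.inl ℝ ℝ (ContactModel n))) q.1 :=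
      HasFDerivAt.comp q.1 (g := γ) (f := fun t : ℝ => (t, q.2)) hq.hasFDerivAt
        (hasFDerivAt_prodMk_left q.1 q.2)
    have e2 := (mfderiv_comp_apply q.1 (hψd _ hs) (hgt (φ.symm q.2) q.1) (1 : ℝ))
    rw [← e2]
    have e3 : mfderiv 𝓘(ℝ, ℝ) 𝓘(ℝ, ContactModel n) (ψ ∘ fun t => g t (φ.symm q.2)) q.1 =
      (fderiv ℝ γ q).comp (ContinuousLinearMap.inl ℝ ℝ (ContactModel n)) := by
      rw [mfderiv_eq_fderiv]
      exact e1.fderiv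
    rw [e3]
    rfl
  have hline : Filter.Tendsto (fun t : ℝ => (t, φ x)) (𝓝 t₀) (𝓝 p₀) :=
    (Continuous.prodMk_left (φ x)).tendsto t₀
  have hcol : Filter.Tendsto (fun y : ContactModel n => (t₀, y)) (𝓝 (φ x)) (𝓝 p₀) :=
    (Continuous.prodMk_right t₀).tendsto (φ x)
  have h2 : ∀ᶠ t in 𝓝 t₀, fderiv ℝ γ (t, φ x) (0, v) =
      mfderiv (𝓡 (2 * n + 1)) 𝓘(ℝ, ContactModel n) ψ (g t x)
        (mfderiv (𝓡 (2 * n + 1)) (𝓡 (2 * n + 1)) (g t) x v) := by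
    filter_upwards [hline.eventually hγdiff, hline.eventually hsrc] with t hq hs
    simp only [hx] at hs
    have e1 : HasFDerivAt (fun y : ContactModel n => γ (t, y))
        ((fderiv ℝ γ (t, φ x)).comp (ContinuousLinearMap.inr ℝ ℝ (ContactModel n))) (φ x) :=
      HasFDerivAt.comp (φ x) (g := γ) (f := fun y : ContactModel n => (t, y)) hq.hasFDerivAt
        (hasFDerivAt_prodMk_right t (φ x))
    have e0 : mfderiv 𝓘(ℝ, ContactModel n) (𝓡 (2 * n + 1)) φ.symm (φ x) =
        ContinuousLinearMap.id ℝ (ContactModel n) := by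
      have := mfderivWithin_range_extChartAt_symm (I := 𝓡 (2 * n + 1)) (x := x)
      rw [ModelWithCorners.range_eq_univ, mfderivWithin_univ] at this
      exact this
    have e2 : HasMFDerivAt 𝓘(ℝ, ContactModel n) (𝓡 (2 * n + 1)) φ.symm (φ x)
        (ContinuousLinearMap.id ℝ (ContactModel n)) := by
      rw [← e0]
      exact (hφs.mdifferentiableAt (by simp)).hasMFDerivAt
    have e3 : HasMFDerivAt (𝓡 (2 * n + 1)) 𝓘(ℝ, ContactModel n) (ψ ∘ g t) x
      ((mfderiv (𝓡 (2 * n + 1)) 𝓘(ℝ, ContactModel n) ψ (g t x)).comp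
        (mfderiv (𝓡 (2 * n + 1)) (𝓡 (2 * n + 1)) (g t) x)) :=
      HasMFDerivAt.comp x (hψd _ hs).hasMFDerivAt (hgm t x).hasMFDerivAt
    have e4 := HasMFDerivAt.comp (φ x) (hasMFDerivAt_of_eq hx e3) e2
    have e6 : HasFDerivAt (fun y : ContactModel n => γ (t, y)) (show ContactModel n →L[ℝ] ContactModel n from
        (mfderiv (𝓡 (2 * n + 1)) 𝓘(ℝ, ContactModel n) ψ (g t x)).comp
          (mfderiv (𝓡 (2 * n + 1)) (𝓡 (2 * n + 1)) (g t) x)) (φ x) :=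
      hasMFDerivAt_iff_hasFDerivAt.1 e4
    have e5 := e6.unique e1
    exact (congrArg (fun L : ContactModel n →L[ℝ] ContactModel n => L v) e5).symm
  have h3 : ∀ᶠ t in 𝓝 t₀, β (t, φ x) (0, v) =
      α.form (g t x) (mfderiv (𝓡 (2 * n + 1)) (𝓡 (2 * n + 1)) (g t) x v) := by
    filter_upwards [h2, hline.eventually hsrc] with t ht hs
    simp only [hx] at hs
    rw [← chartForm_apply α (g t₀ x) (g t x) hs]
    simp only [hβ, ContinuousLinearMap.comp_apply]
    have e1 : γ (t, φ x) = ψ (g t x) := by simp only [γ, hx]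
    rw [ht, e1]
  have h4 : ∀ᶠ y in 𝓝 (φ x), β (t₀, y) (1, 0) = c := by
    filter_upwards [hcol.eventually h1, hcol.eventually hsrc] with y hy hs
    refine Eq.trans ?_ (hc (φ.symm y))
    rw [← chartForm_apply α (g t₀ x) _ hs]
    simp only [hβ, ContinuousLinearMap.comp_apply]
    rw [hy]
  have h5 : HasDerivAt (fun t => β (t, φ x) (0, v)) (B (1, 0) (0, v)) t₀ := by
    have e1 : HasFDerivAt (fun t => β (t, φ x))
        (B.comp (ContinuousLinearMap.inl ℝ ℝ (ContactModel n))) t₀ :=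
      HasFDerivAt.comp t₀ (g := β) (f := fun t : ℝ => (t, φ x)) hB (hasFDerivAt_prodMk_left t₀ (φ x))
    have e2 := e1.hasDerivAt.clm_apply (hasDerivAt_const t₀ ((0, v) : ℝ × ContactModel n))
    simpa using e2
  have h6 : B (0, v) (1, 0) = 0 := by
    have e1 : HasFDerivAt (fun y => β (t₀, y))
        (B.comp (ContinuousLinearMap.inr ℝ ℝ (ContactModel n))) (φ x) :=
      HasFDerivAt.comp (φ x) (g := β) (f := fun y : ContactModel n => (t₀, y)) hB
        (hasFDerivAt_prodMk_right t₀ (φ x))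
    have e2 := e1.clm_apply (hasFDerivAt_const ((1, 0) : ℝ × ContactModel n) (φ x))
    have e3 : HasFDerivAt (fun y => β (t₀, y) (1, 0)) (0 : ContactModel n →L[ℝ] ℝ) (φ x) :=
      (hasFDerivAt_const c (φ x)).congr_of_eventuallyEq h4
    have e4 : ∀ w : ContactModel n, B (0, w) (1, 0) = 0 := fun w => by
      simpa using congrArg (fun L : ContactModel n →L[ℝ] ℝ => L w) (e2.unique e3)
    exact e4 v
  have hψid : mfderiv (𝓡 (2 * n + 1)) 𝓘(ℝ, ContactModel n) ψ (g t₀ x) =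
      ContinuousLinearMap.id ℝ _ := mfderiv_extChartAt_self
  have h7 := hBs (1, 0) (0, v)
  rw [h6, sub_zero] at h7
  have h8 := h1.self_of_nhds.trans (congrArg (fun x' : V =>
    (mfderiv (𝓡 (2 * n + 1)) 𝓘(ℝ, ContactModel n) ψ (g t₀ x')
      (mfderiv 𝓘(ℝ, ℝ) (𝓡 (2 * n + 1)) (fun t => g t x') t₀ (1 : ℝ)) : ContactModel n)) hx)
  have h9 := h2.self_of_nhds
  rw [hψid] at h8 h9
  have h10 : B (1, 0) (0, v) = dForm α.form (g t₀ x)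
        (mfderiv 𝓘(ℝ, ℝ) (𝓡 (2 * n + 1)) (fun t => g t x) t₀ (1 : ℝ))
        (mfderiv (𝓡 (2 * n + 1)) (𝓡 (2 * n + 1)) (g t₀) x v) := by
    rw [h7, hγ0]
    simp only [p₀]
    rw [h8, h9]
    rfl
  rw [← h10]
  exact h5.congr_of_eventuallyEq (h3.mono fun t ht => ht.symm)


theorem ReebCircleAction.velocity {α : ContactForm n V} (S : ReebCircleAction α) (t : ℝ) (x : V) :
    mfderiv 𝓘(ℝ, ℝ) (𝓡 (2 * n + 1)) (fun t => S.flow t x) t (1 : ℝ) = S.reeb (S.flow t x) := by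
  have h := (S.integral x t).mfderiv
  rw [h]
  exact one_smul ℝ (S.reeb (S.flow t x))

/-- The Reeb flow preserves the contact form. -/
theorem ReebCircleAction.form_mfderiv_flow {α : ContactForm n V} (S : ReebCircleAction α) (t : ℝ)
    (x : V) (v : TangentSpace (𝓡 (2 * n + 1)) x) :
    α.form (S.flow t x) (mfderiv (𝓡 (2 * n + 1)) (𝓡 (2 * n + 1)) (S.flow t) x v) =
      α.form x v := by
  have hd : ∀ s, HasDerivAt (fun t => α.form (S.flow t x)
      (mfderiv (𝓡 (2 * n + 1)) (𝓡 (2 * n + 1)) (S.flow t) x v)) 0 s := by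
    intro s
    have h := hasDerivAt_pullback α S.flow S.smooth s x v 1 (fun y => by
      rw [S.velocity]; exact S.form_reeb _)
    rwa [S.velocity, S.dForm_reeb] at h
  have h1 := is_const_of_deriv_eq_zero (fun s => (hd s).differentiableAt)
    (fun s => (hd s).deriv) t 0
  have h0 : S.flow 0 = id := funext S.flow_zero
  have key : ∀ f : V → V, f = id → α.form (f x)
      (mfderiv (𝓡 (2 * n + 1)) (𝓡 (2 * n + 1)) f x v) = α.form x v := by
    rintro _ rfl
    rw [mfderiv_id]
    rfl
  exact h1.trans (key _ h0)

/-- A contactomorphism: a diffeomorphism `f` of `V` preserving the contact structure `ker α` and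
its co-orientation, i.e. `f^* α = ρ α` for a positive function `ρ` (the field `factor`, which
`f` determines). -/
structure Contactomorphism (α : ContactForm n V) extends
    Diffeomorph (𝓡 (2 * n + 1)) (𝓡 (2 * n + 1)) V V ∞ where
  factor : V → ℝ
  factor_pos : ∀ x, 0 < factor x
  form_mfderiv : ∀ (x : V) (v : TangentSpace (𝓡 (2 * n + 1)) x),
    α.form (toDiffeomorph x)
      (mfderiv (𝓡 (2 * n + 1)) (𝓡 (2 * n + 1)) toDiffeomorph x v) = factor x * α.form x v

instance {α : ContactForm n V} : CoeFun (Contactomorphism α) (fun _ => V → V) :=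
  ⟨fun f => f.toDiffeomorph⟩

/-- The inverse map of a contactomorphism. -/
def Contactomorphism.inv {α : ContactForm n V} (f : Contactomorphism α) : V → V :=
  f.toDiffeomorph.symm

/-- The time-`t` map `e_t` of the Reeb flow, as a contactomorphism. -/
def ReebCircleAction.contactFlow {α : ContactForm n V} (S : ReebCircleAction α) (t : ℝ) :
    Contactomorphism α where
  toFun := S.flow t
  invFun := S.flow (-t)
  left_inv x := by rw [← S.flow_add, neg_add_cancel, S.flow_zero]
  right_inv x := by rw [← S.flow_add, add_neg_cancel, S.flow_zero]
  contMDiff_toFun := S.smooth.comp (contMDiff_const.prodMk contMDiff_id)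
  contMDiff_invFun := S.smooth.comp (contMDiff_const.prodMk contMDiff_id)
  factor _ := 1
  factor_pos _ := one_pos
  form_mfderiv x v := by
    rw [one_mul]
    exact S.form_mfderiv_flow t x v

/-- The symplectization `SV = V × ℝ_+` (with the symplectic form `d(s α)`), points `(x, s)`. -/
abbrev Symplectization (V : Type*) : Type _ := V × Set.Ioi (0 : ℝ)

/-- The lift of a contactomorphism `f` with `f^* α = ρ α` to the `ℝ_+`-equivariant
symplectomorphism `(x, s) ↦ (f x, s / ρ(x))` of `SV`, which preserves the primitive `s α`. -/
def Contactomorphism.lift {α : ContactForm n V} (f : Contactomorphism α)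
    (z : Symplectization V) : Symplectization V :=
  (f z.1, ⟨z.2 / f.factor z.1, div_pos z.2.2 (f.factor_pos z.1)⟩)

/-- A contact isotopy: a family of contactomorphisms `p_t`, smooth jointly with its inverses. -/
structure ContactIsotopy (α : ContactForm n V) where
  map : ℝ → Contactomorphism α
  smooth : ContMDiff (𝓘(ℝ, ℝ).prod (𝓡 (2 * n + 1))) (𝓡 (2 * n + 1)) ∞
    (fun q : ℝ × V => map q.1 q.2)
  smooth_inv : ContMDiff (𝓘(ℝ, ℝ).prod (𝓡 (2 * n + 1))) (𝓡 (2 * n + 1)) ∞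
    (fun q : ℝ × V => (map q.1).inv q.2)

/-- The contact Hamiltonian `H_t(x, s) = s α_x(X_t(x))` on `SV` of a contact isotopy `p_t` with
velocity field `X_t = (∂_t p_t) ∘ p_t⁻¹`. This is the `ℝ_+`-equivariant Hamiltonian generating
the lifted isotopy with respect to `d(s α)`: a vector field `Y` on `SV` preserving `s α`
satisfies `ι_Y d(s α) = - d(s α(Y))`. The Reeb flow `e_t` has Hamiltonian `s`. -/
def ContactIsotopy.hamiltonian {α : ContactForm n V} (p : ContactIsotopy α) (t : ℝ)
    (z : Symplectization V) : ℝ :=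
  z.2 * α.form (p.map t ((p.map t).inv z.1))
    (mfderiv 𝓘(ℝ, ℝ) (𝓡 (2 * n + 1)) (fun τ => p.map τ ((p.map t).inv z.1)) t (1 : ℝ))

/-- A smooth path `p_t`, `0 ≤ t ≤ 1`, from the identity in the group `𝒢_e` of contactomorphisms
of the form `e_c ∘ φ` with `φ` in the identity component of the compactly supported ones: outside
a compact set `p_t` coincides with `e_{c(t)}`. (Paths are smooth past the ends of `[0, 1]`, and
nothing but smoothness and contactness is required there.) If `V` is compact, this is any path
of contactomorphisms from the identity. -/
structure PathGe {α : ContactForm n V} (S : ReebCircleAction α) extends ContactIsotopy α where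
  map_zero : ∀ x, map 0 x = x
  eq_flow : ∃ c : ℝ → ℝ, ContDiff ℝ ∞ c ∧ ∃ K : Set V, IsCompact K ∧
    ∀ t ∈ Icc (0 : ℝ) 1, ∀ x ∉ K, map t x = S.flow (c t) x

/-- The path lies in the identity component `𝒢_c` of the compactly supported
contactomorphisms. -/
def PathGe.IsCompactlySupported {α : ContactForm n V} {S : ReebCircleAction α}
    (p : PathGe S) : Prop :=
  ∃ K : Set V, IsCompact K ∧ ∀ t ∈ Icc (0 : ℝ) 1, ∀ x ∉ K, p.map t x = x

/-- Smooth homotopy in `𝒢_e` of paths on `[0, 1]` with fixed end points. -/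
def Homotopic {α : ContactForm n V} {S : ReebCircleAction α} (p q : PathGe S) : Prop :=
  ∃ k : ℝ → ℝ → Contactomorphism α,
    ContMDiff (𝓘(ℝ, ℝ × ℝ).prod (𝓡 (2 * n + 1))) (𝓡 (2 * n + 1)) ∞
      (fun y : (ℝ × ℝ) × V => k y.1.1 y.1.2 y.2) ∧
    ContMDiff (𝓘(ℝ, ℝ × ℝ).prod (𝓡 (2 * n + 1))) (𝓡 (2 * n + 1)) ∞
      (fun y : (ℝ × ℝ) × V => (k y.1.1 y.1.2).inv y.2) ∧
    (∃ c : ℝ × ℝ → ℝ, ContDiff ℝ ∞ c ∧ ∃ K : Set V, IsCompact K ∧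
      ∀ u ∈ Icc (0 : ℝ) 1, ∀ t ∈ Icc (0 : ℝ) 1, ∀ x ∉ K, k u t x = S.flow (c (u, t)) x) ∧
    (∀ t ∈ Icc (0 : ℝ) 1, ∀ x, k 0 t x = p.map t x) ∧
    (∀ t ∈ Icc (0 : ℝ) 1, ∀ x, k 1 t x = q.map t x) ∧
    (∀ u ∈ Icc (0 : ℝ) 1, ∀ x, k u 0 x = x) ∧
    (∀ u ∈ Icc (0 : ℝ) 1, ∀ x, k u 1 x = p.map 1 x)

/-- The universal cover of `𝒢_e`: homotopy classes, with fixed end points, of paths from the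
identity. -/
def UniversalCover {α : ContactForm n V} (S : ReebCircleAction α) : Type _ :=
  Quot (Homotopic (S := S))

/-- The class of a path in the universal cover. -/
def PathGe.toCover {α : ContactForm n V} {S : ReebCircleAction α} (p : PathGe S) :
    UniversalCover S :=
  Quot.mk _ p

/-- The universal cover of `𝒢_c`, as a subset of that of `𝒢_e`. -/
def coverGc {α : ContactForm n V} (S : ReebCircleAction α) : Set (UniversalCover S) :=
  {F | ∃ p : PathGe S, p.IsCompactlySupported ∧ p.toCover = F}

/-- The path `t ↦ e_{ct}`, representing the element `e^c` of the universal cover. -/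
def reebPath {α : ContactForm n V} (S : ReebCircleAction α) (c : ℝ) : PathGe S where
  map t := S.contactFlow (c * t)
  smooth := S.smooth.comp
    (((contMDiff_const (c := c)).mul contMDiff_fst).prodMk contMDiff_snd)
  smooth_inv := S.smooth.comp
    (((contMDiff_const (c := c)).mul contMDiff_fst).neg.prodMk contMDiff_snd)
  map_zero x := by
    change S.flow (c * 0) x = x
    rw [mul_zero, S.flow_zero]
  eq_flow := ⟨fun t => c * t, contDiff_const.mul contDiff_id, ∅, isCompact_empty,
    fun _ _ _ _ => rfl⟩

/-- `F ⪰ id`: some path in the class `F` has a non-negative contact Hamiltonian. -/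
def IsNonneg {α : ContactForm n V} {S : ReebCircleAction α} (F : UniversalCover S) : Prop :=
  ∃ h : PathGe S, h.toCover = F ∧ ∀ t ∈ Icc (0 : ℝ) 1, ∀ z, 0 ≤ h.hamiltonian t z

/-- `F ⪰ G`: `F G⁻¹ ⪰ id`, where `F G⁻¹` is the class of the path `k_t = f_t g_t⁻¹` for
representatives `f_t`, `g_t` of `F`, `G`. -/
def Succeq {α : ContactForm n V} {S : ReebCircleAction α} (F G : UniversalCover S) : Prop :=
  ∃ f g k : PathGe S, f.toCover = F ∧ g.toCover = G ∧
    (∀ t x, k.map t (g.map t x) = f.map t x) ∧ IsNonneg k.toCover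

/-- `ν_+(F) = min {m ∈ ℤ : e^m ⪰ F}`. -/
def nuPlus {α : ContactForm n V} {S : ReebCircleAction α} (F : UniversalCover S) : ℤ :=
  sInf {m : ℤ | Succeq (reebPath S m).toCover F}

/-- `ν_-(F) = max {m ∈ ℤ : F ⪰ e^m}`. -/
def nuMinus {α : ContactForm n V} {S : ReebCircleAction α} (F : UniversalCover S) : ℤ :=
  sSup {m : ℤ | Succeq F (reebPath S m).toCover}

/-- `ν(F) = max (|ν_+(F)|, |ν_-(F)|)`. -/
def nu {α : ContactForm n V} {S : ReebCircleAction α} (F : UniversalCover S) : ℤ :=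
  max |nuPlus F| |nuMinus F|

/-- `ν_*(f) = inf ν(g)` over all lifts `g` of `f ∈ 𝒢_c` to the universal cover of `𝒢_c`, i.e.
over the classes of all compactly supported paths from the identity to `f`. -/
def nuStar {α : ContactForm n V} (S : ReebCircleAction α) (f : Contactomorphism α) : ℝ :=
  sInf {r : ℝ | ∃ g : PathGe S, g.IsCompactlySupported ∧ (∀ x, g.map 1 x = f x) ∧
    r = nu g.toCover}

/-- The path is a smooth loop: it is 1-periodic in time (so also `φ_1 = φ_0 = id`). -/
def PathGe.IsLoop {α : ContactForm n V} {S : ReebCircleAction α} (φ : PathGe S) : Prop :=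
  ∀ t x, φ.map (t + 1) x = φ.map t x

/-- The homotopy class of `φ` lies in `Π`, the image of the fundamental group of `𝒢_c` in that
of `𝒢_e`. -/
def PathGe.RepresentsPi {α : ContactForm n V} {S : ReebCircleAction α} (φ : PathGe S) : Prop :=
  ∃ ψ : PathGe S, ψ.IsCompactlySupported ∧ (∀ x, ψ.map 1 x = x) ∧ φ.toCover = ψ.toCover

/-- The total space `SV × T^*S^1` of the stabilization, with points `(z, r, t)`, `S^1 = ℝ/ℤ`. -/
abbrev Stabilization (V : Type*) : Type _ := Symplectization V × ℝ × AddCircle (1 : ℝ)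

/-- For `X ⊆ SV`, the subset `X × S^1` of `SV × T^*S^1`, where `S^1` is the zero section. -/
def stab (X : Set (Symplectization V)) : Set (Stabilization V) :=
  {y | y.1 ∈ X ∧ y.2.1 = 0}

/-- The suspension `(z, r, t) ↦ (φ_t z, r - Φ_t(φ_t z), t)` of a loop `φ` with contact Hamiltonian
`Φ`; here `φ_t` acts on `SV` by its lift and `τ ∈ [0, 1)` is the representative of `t ∈ ℝ/ℤ`. -/
def PathGe.suspension {α : ContactForm n V} {S : ReebCircleAction α} (φ : PathGe S)
    (y : Stabilization V) : Stabilization V :=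
  let τ : ℝ := AddCircle.equivIco (1 : ℝ) 0 y.2.2
  let w := (φ.map τ).lift y.1
  (w, y.2.1 - φ.hamiltonian τ w, y.2.2)

/-- The strong stable intersection property of a pair `(A, B)` of subsets of `SV`. -/
def StrongStableIntersection {α : ContactForm n V} (S : ReebCircleAction α)
    (A B : Set (Symplectization V)) : Prop :=
  IsCompact B ∧ ∀ φ : PathGe S, φ.IsLoop → φ.RepresentsPi →
    ((φ.suspension '' stab A) ∩ stab B).Nonempty

end ContactGeometry

end

noncomputable section

namespace ContactGeometry

/-! The heart is a bound on `ν_+`: if `g` is a compactly supported path ending at `f_1` and `e^m ⪰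
g`, then `c ≤ m`. Suppose instead that `m < c`. Let `h` be a non-negative path in the class `e^m
g⁻¹`; since `e_m = id`, it ends at `f_1⁻¹`. The path `ψ_t = e_{-mt} f_t h_t` is then a loop. Its
class is that of `e_{-mt} p_t e_{mt} g_t⁻¹`, where `p` is a compactly supported representative of
`f`, so it lies in `Π`. The intersection property gives a time `τ` and a point `z` such that the
lift of `ψ_τ` sends `z` into `B` and the Hamiltonian of `ψ` vanishes there. Because `B` is invariant
under the Reeb flow, applying `e_{mτ}` gives a point of `B` at which `F_τ > cs`. Up to a positive
factor, the Hamiltonian of `ψ` is therefore `-m`, plus something larger than `c`, plus something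
non-negative, hence positive: a contradiction (`le_of_succeq_reebPath`).

The loop has to be smooth as a periodic family. For this `h` is run through a step function,
constant near both ends, and periodicity of `F_t` is converted into `f_{t+1} = f_t f_1`
(`ContactIsotopy.map_add_one_of_periodic`). The latter rests on the fact that a contact isotopy with
zero Hamiltonian is constant. Hamiltonians are handled through the `speed` `α(∂_t p_t)`, which obeys
a product rule (`speed_comp`).

Finally, some `m` with `e^m ⪰ g` exists (`exists_succeq`), because a compactly supported path has
bounded speed. Thus `ν_+(g)` is a genuine minimum, at least `⌈c⌉`, for every lift `g`. -/

theorem velocity_comp {n : ℕ} {V : Type*} [TopologicalSpace V]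
    [ChartedSpace (ContactModel n) V] {γ : ℝ → V} {β : ℝ → ℝ} {t b : ℝ}
    (hγ : MDifferentiableAt 𝓘(ℝ, ℝ) (𝓡 (2 * n + 1)) γ (β t)) (hβ : HasDerivAt β b t) :
    (mfderiv 𝓘(ℝ, ℝ) (𝓡 (2 * n + 1)) (fun τ => γ (β τ)) t (1 : ℝ) : ContactModel n) =
      b • mfderiv 𝓘(ℝ, ℝ) (𝓡 (2 * n + 1)) γ (β t) (1 : ℝ) := by
  have h1 := (HasMFDerivAt.comp t hγ.hasMFDerivAt hβ.hasFDerivAt.hasMFDerivAt).mfderiv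
  refine (congrArg (fun L : ℝ →L[ℝ] ContactModel n => L 1) h1).trans ?_
  let L : ℝ →L[ℝ] ContactModel n := mfderiv 𝓘(ℝ, ℝ) (𝓡 (2 * n + 1)) γ (β t)
  change L ((1 : ℝ) • b) = b • L 1
  rw [one_smul, ← map_smul, smul_eq_mul, mul_one]

variable {n : ℕ} {V : Type*} [TopologicalSpace V] [ChartedSpace (ContactModel n) V]
  [IsManifold (𝓡 (2 * n + 1)) ∞ V] {α : ContactForm n V}

/-! ### Composition and inversion of contactomorphisms -/

namespace Contactomorphism

@[simp]
theorem apply_inv (f : Contactomorphism α) (x : V) : f (f.inv x) = x :=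
  f.toDiffeomorph.apply_symm_apply x

@[simp]
theorem inv_apply (f : Contactomorphism α) (x : V) : f.inv (f x) = x :=
  f.toDiffeomorph.symm_apply_apply x

theorem mdifferentiable (f : Contactomorphism α) :
    MDifferentiable (𝓡 (2 * n + 1)) (𝓡 (2 * n + 1)) f :=
  f.toDiffeomorph.mdifferentiable (by simp)

theorem mdifferentiable_inv (f : Contactomorphism α) :
    MDifferentiable (𝓡 (2 * n + 1)) (𝓡 (2 * n + 1)) f.inv :=
  f.toDiffeomorph.symm.mdifferentiable (by simp)

/-- The composition `f ∘ g` of two contactomorphisms. -/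
def comp (f g : Contactomorphism α) : Contactomorphism α where
  toDiffeomorph := g.toDiffeomorph.trans f.toDiffeomorph
  factor x := f.factor (g x) * g.factor x
  factor_pos x := mul_pos (f.factor_pos _) (g.factor_pos _)
  form_mfderiv x v := by
    have h : mfderiv (𝓡 (2 * n + 1)) (𝓡 (2 * n + 1)) (f ∘ g) x v =
        mfderiv (𝓡 (2 * n + 1)) (𝓡 (2 * n + 1)) f (g x)
          (mfderiv (𝓡 (2 * n + 1)) (𝓡 (2 * n + 1)) g x v) :=
      mfderiv_comp_apply x (f.mdifferentiable _) (g.mdifferentiable _) v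
    rw [mul_assoc, ← g.form_mfderiv, ← f.form_mfderiv]
    exact congrArg (α.form (f (g x))) h

@[simp]
theorem comp_apply (f g : Contactomorphism α) (x : V) : f.comp g x = f (g x) := rfl

theorem mfderiv_apply_mfderiv_inv (f : Contactomorphism α) (x : V)
    (v : TangentSpace (𝓡 (2 * n + 1)) x) :
    mfderiv (𝓡 (2 * n + 1)) (𝓡 (2 * n + 1)) f (f.inv x)
      (mfderiv (𝓡 (2 * n + 1)) (𝓡 (2 * n + 1)) f.inv x v) = v := by
  have h := mfderiv_comp_apply x (f.mdifferentiable (f.inv x)) (f.mdifferentiable_inv x) v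
  have h1 : (f : V → V) ∘ f.inv = id := funext f.apply_inv
  rw [← h, h1, mfderiv_id]
  rfl

/-- The inverse of a contactomorphism, as a contactomorphism. -/
def symm (f : Contactomorphism α) : Contactomorphism α where
  toDiffeomorph := f.toDiffeomorph.symm
  factor x := (f.factor (f.inv x))⁻¹
  factor_pos x := inv_pos.2 (f.factor_pos _)
  form_mfderiv x v := by
    have h := f.form_mfderiv (f.inv x) (mfderiv (𝓡 (2 * n + 1)) (𝓡 (2 * n + 1)) f.inv x v)
    have h1 := f.mfderiv_apply_mfderiv_inv x v
    -- The tangent space depends on the base point, so `f (f.inv x) = x` is substituted in the point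
    -- and the vector together.
    have key : ∀ (y : V) (w : ContactModel n), y = x → w = v → α.form y w = α.form x v := by
      rintro _ _ rfl rfl
      rfl
    have h2 := (key _ _ (f.apply_inv x) h1).symm.trans h
    rw [h2, inv_mul_cancel_left₀ (f.factor_pos _).ne']
    rfl

theorem inv_eq_of_apply_eq {f : Contactomorphism α} {x y : V} (h : f x = y) : f.inv y = x := by
  rw [← h, inv_apply]

theorem inv_congr {f g : Contactomorphism α} (h : ∀ x, f x = g x) (x : V) : f.inv x = g.inv x :=
  inv_eq_of_apply_eq (by rw [h, apply_inv])

end Contactomorphism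

/-! ### Smooth families and the Reeb flow at infinity -/

section Families

variable {P Q : Type*} [NormedAddCommGroup P] [NormedSpace ℝ P]
  [NormedAddCommGroup Q] [NormedSpace ℝ Q]

/-- A family of contactomorphisms, smooth jointly with its inverses. -/
structure SmoothFamily (k : P → Contactomorphism α) : Prop where
  smooth : ContMDiff (𝓘(ℝ, P).prod (𝓡 (2 * n + 1))) (𝓡 (2 * n + 1)) ∞
    (fun q : P × V => k q.1 q.2)
  smooth_inv : ContMDiff (𝓘(ℝ, P).prod (𝓡 (2 * n + 1))) (𝓡 (2 * n + 1)) ∞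
    (fun q : P × V => (k q.1).inv q.2)

namespace SmoothFamily

theorem comp {k l : P → Contactomorphism α} (hk : SmoothFamily k) (hl : SmoothFamily l) :
    SmoothFamily (fun p => (k p).comp (l p)) :=
  ⟨hk.smooth.comp (contMDiff_fst.prodMk hl.smooth),
    hl.smooth_inv.comp (contMDiff_fst.prodMk hk.smooth_inv)⟩

theorem symm {k : P → Contactomorphism α} (hk : SmoothFamily k) :
    SmoothFamily (fun p => (k p).symm) :=
  ⟨hk.smooth_inv, hk.smooth⟩

theorem reparam {k : P → Contactomorphism α} (hk : SmoothFamily k) {σ : Q → P}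
    (hσ : ContDiff ℝ ∞ σ) : SmoothFamily (fun q => k (σ q)) :=
  ⟨hk.smooth.comp ((hσ.contMDiff.comp contMDiff_fst).prodMk contMDiff_snd),
    hk.smooth_inv.comp ((hσ.contMDiff.comp contMDiff_fst).prodMk contMDiff_snd)⟩

end SmoothFamily

/-- For `p ∈ T`, the contactomorphism `k p` is, outside a compact set independent of `p`, a
time-`c(p)` map of the Reeb flow. -/
def IsFlowAtInfinity (S : ReebCircleAction α) (T : Set P) (k : P → Contactomorphism α) : Prop :=
  ∃ c : P → ℝ, ContDiff ℝ ∞ c ∧ ∃ K : Set V, IsCompact K ∧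
    ∀ p ∈ T, ∀ x ∉ K, k p x = S.flow (c p) x

end Families

namespace ReebCircleAction

variable (S : ReebCircleAction α)

theorem flow_int (m : ℤ) (x : V) : S.flow m x = x := by
  have hnat : ∀ (k : ℕ) (y : V), S.flow k y = y := by
    intro k
    induction k with
    | zero => intro y; simpa using S.flow_zero y
    | succ k ih => intro y; rw [Nat.cast_succ, S.flow_add, S.flow_one, ih]
  obtain ⟨k, rfl | rfl⟩ := m.eq_nat_or_neg
  · simpa using hnat k x
  · have h := S.flow_add (-(k : ℝ)) k x
    rw [neg_add_cancel, S.flow_zero, hnat] at h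
    simpa using h.symm

theorem flow_fract (t : ℝ) (x : V) : S.flow (Int.fract t) x = S.flow t x := by
  rw [← S.flow_int ⌊t⌋ x, ← S.flow_add, ← S.flow_add, Int.fract_add_floor, add_comm,
    S.flow_add, S.flow_int]

/-- The saturation of a set under the Reeb flow. -/
def saturation (K : Set V) : Set V :=
  {x | ∃ t, ∃ y ∈ K, S.flow t y = x}

/-- By 1-periodicity, times in `[0, 1]` already sweep out the saturation. Off it, Reeb orbits never
meet `K`, which keeps products and inverses equal to Reeb maps outside a compact set. -/
theorem isCompact_saturation {K : Set V} (hK : IsCompact K) : IsCompact (S.saturation K) := by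
  have h : S.saturation K = (fun p : ℝ × V => S.flow p.1 p.2) '' (Icc 0 1 ×ˢ K) := by
    ext x
    constructor
    · rintro ⟨t, y, hy, rfl⟩
      exact ⟨(Int.fract t, y), ⟨⟨Int.fract_nonneg t, (Int.fract_lt_one t).le⟩, hy⟩,
        S.flow_fract t y⟩
    · rintro ⟨⟨t, y⟩, ⟨-, hy⟩, rfl⟩
      exact ⟨t, y, hy, rfl⟩
  rw [h]
  exact (isCompact_Icc.prod hK).image S.smooth.continuous

theorem flow_neg_flow (t : ℝ) (x : V) : S.flow (-t) (S.flow t x) = x := by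
  rw [← S.flow_add, neg_add_cancel, S.flow_zero]

theorem flow_flow_neg (t : ℝ) (x : V) : S.flow t (S.flow (-t) x) = x := by
  rw [← S.flow_add, add_neg_cancel, S.flow_zero]

theorem flow_notMem {K : Set V} {x : V} (hx : x ∉ S.saturation K) (t : ℝ) : S.flow t x ∉ K :=
  fun h => hx ⟨-t, _, h, S.flow_neg_flow t x⟩

end ReebCircleAction

namespace IsFlowAtInfinity

variable {P Q : Type*} [NormedAddCommGroup P] [NormedSpace ℝ P]
  [NormedAddCommGroup Q] [NormedSpace ℝ Q] {S : ReebCircleAction α} {T : Set P}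

theorem comp {k l : P → Contactomorphism α} (hk : IsFlowAtInfinity S T k)
    (hl : IsFlowAtInfinity S T l) : IsFlowAtInfinity S T (fun p => (k p).comp (l p)) := by
  obtain ⟨c, hc, K, hK, hck⟩ := hk
  obtain ⟨d, hd, L, hL, hdl⟩ := hl
  refine ⟨fun p => c p + d p, hc.add hd, S.saturation K ∪ L,
    (S.isCompact_saturation hK).union hL, fun p hp x hx => ?_⟩
  rw [mem_union, not_or] at hx
  rw [Contactomorphism.comp_apply, hdl p hp x hx.2, hck p hp _ (S.flow_notMem hx.1 _), S.flow_add]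

theorem symm {k : P → Contactomorphism α} (hk : IsFlowAtInfinity S T k) :
    IsFlowAtInfinity S T (fun p => (k p).symm) := by
  obtain ⟨c, hc, K, hK, hck⟩ := hk
  refine ⟨fun p => -c p, hc.neg, S.saturation K, S.isCompact_saturation hK, fun p hp x hx => ?_⟩
  refine Contactomorphism.inv_eq_of_apply_eq ?_
  rw [hck p hp _ (S.flow_notMem hx _), S.flow_flow_neg]

theorem reparam {k : P → Contactomorphism α} (hk : IsFlowAtInfinity S T k) {T' : Set Q}
    {σ : Q → P} (hσ : ContDiff ℝ ∞ σ) (hT : MapsTo σ T' T) :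
    IsFlowAtInfinity S T' (fun q => k (σ q)) := by
  obtain ⟨c, hc, K, hK, hck⟩ := hk
  exact ⟨fun q => c (σ q), hc.comp hσ, K, hK, fun q hq x hx => hck _ (hT hq) x hx⟩

end IsFlowAtInfinity

variable {S : ReebCircleAction α}

/-! ### Products, inverses and reparametrizations in the universal cover -/

namespace PathGe

theorem smoothFamily (p : PathGe S) : SmoothFamily p.map := ⟨p.smooth, p.smooth_inv⟩

theorem isFlowAtInfinity (p : PathGe S) : IsFlowAtInfinity S (Icc 0 1) p.map := p.eq_flow

/-- A path in `𝒢_e` from a smooth family of contactomorphisms. -/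
def ofFamily (k : ℝ → Contactomorphism α) (hk : SmoothFamily k)
    (hS : IsFlowAtInfinity S (Icc 0 1) k) (h0 : ∀ x, k 0 x = x) : PathGe S where
  map := k
  smooth := hk.smooth
  smooth_inv := hk.smooth_inv
  map_zero := h0
  eq_flow := hS

/-- The pointwise composition of two paths. -/
def mul (p q : PathGe S) : PathGe S :=
  ofFamily (fun t => (p.map t).comp (q.map t)) (p.smoothFamily.comp q.smoothFamily)
    (p.isFlowAtInfinity.comp q.isFlowAtInfinity) (fun x => by simp [p.map_zero, q.map_zero])

/-- The pointwise inverse of a path. -/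
def inv (p : PathGe S) : PathGe S :=
  ofFamily (fun t => (p.map t).symm) p.smoothFamily.symm p.isFlowAtInfinity.symm
    (fun x => Contactomorphism.inv_eq_of_apply_eq (p.map_zero x))

/-- The path `t ↦ p_{β(t)}`. -/
def reparam (p : PathGe S) (β : ℝ → ℝ) (hβ : ContDiff ℝ ∞ β)
    (hI : MapsTo β (Icc 0 1) (Icc 0 1)) (h0 : β 0 = 0) : PathGe S :=
  ofFamily (fun t => p.map (β t)) (p.smoothFamily.reparam hβ)
    (p.isFlowAtInfinity.reparam hβ hI) (fun x => by rw [h0, p.map_zero])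

@[simp]
theorem mul_map (p q : PathGe S) (t : ℝ) (x : V) : (p.mul q).map t x = p.map t (q.map t x) := rfl

@[simp]
theorem inv_map (p : PathGe S) (t : ℝ) (x : V) : p.inv.map t x = (p.map t).inv x := rfl

@[simp]
theorem reparam_map (p : PathGe S) (β : ℝ → ℝ) (hβ : ContDiff ℝ ∞ β)
    (hI : MapsTo β (Icc 0 1) (Icc 0 1)) (h0 : β 0 = 0) (t : ℝ) :
    (p.reparam β hβ hI h0).map t = p.map (β t) := rfl

end PathGe

@[simp]
theorem reebPath_map (c t : ℝ) (x : V) : (reebPath S c).map t x = S.flow (c * t) x := rfl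

theorem homotopic_iff {p q : PathGe S} : Homotopic p q ↔
    ∃ k : ℝ × ℝ → Contactomorphism α, SmoothFamily k ∧
      IsFlowAtInfinity S (Icc 0 1 ×ˢ Icc 0 1) k ∧
      (∀ t ∈ Icc (0 : ℝ) 1, ∀ x, k (0, t) x = p.map t x) ∧
      (∀ t ∈ Icc (0 : ℝ) 1, ∀ x, k (1, t) x = q.map t x) ∧
      (∀ u ∈ Icc (0 : ℝ) 1, ∀ x, k (u, 0) x = x) ∧
      (∀ u ∈ Icc (0 : ℝ) 1, ∀ x, k (u, 1) x = p.map 1 x) := by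
  constructor
  · rintro ⟨k, h1, h2, ⟨c, hc, K, hK, h3⟩, h4, h5, h6, h7⟩
    exact ⟨fun y => k y.1 y.2, ⟨h1, h2⟩, ⟨c, hc, K, hK, fun y hy => h3 y.1 hy.1 y.2 hy.2⟩,
      h4, h5, h6, h7⟩
  · rintro ⟨k, ⟨h1, h2⟩, ⟨c, hc, K, hK, h3⟩, h4, h5, h6, h7⟩
    exact ⟨fun u t => k (u, t), h1, h2, ⟨c, hc, K, hK, fun u hu t ht => h3 (u, t) ⟨hu, ht⟩⟩,
      h4, h5, h6, h7⟩

theorem Homotopic.of_eqOn {p q : PathGe S}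
    (h : ∀ t ∈ Icc (0 : ℝ) 1, ∀ x, p.map t x = q.map t x) : Homotopic p q :=
  homotopic_iff.2 ⟨fun y => p.map y.2, p.smoothFamily.reparam contDiff_snd,
    p.isFlowAtInfinity.reparam contDiff_snd fun _ hy => hy.2, fun _ _ _ => rfl, h,
    fun _ _ x => p.map_zero x, fun _ _ _ => rfl⟩

theorem Homotopic.map_one {p q : PathGe S} (h : Homotopic p q) (x : V) :
    p.map 1 x = q.map 1 x := by
  obtain ⟨k, -, -, -, h5, -, h7⟩ := homotopic_iff.1 h
  rw [← h7 1 (by simp), h5 1 (by simp)]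

theorem Homotopic.mul {p p' q q' : PathGe S} (h : Homotopic p p') (h' : Homotopic q q') :
    Homotopic (p.mul q) (p'.mul q') := by
  obtain ⟨k, h1, h2, h3, h4, h5, h6⟩ := homotopic_iff.1 h
  obtain ⟨k', h1', h2', h3', h4', h5', h6'⟩ := homotopic_iff.1 h'
  refine homotopic_iff.2 ⟨_, h1.comp h1', h2.comp h2', ?_, ?_, ?_, ?_⟩
  · intro t ht x; simp [h3 t ht, h3' t ht]
  · intro t ht x; simp [h4 t ht, h4' t ht]
  · intro t ht x; simp [h5 t ht, h5' t ht]
  · intro t ht x; simp [h6 t ht, h6' t ht]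

theorem Homotopic.inv {p q : PathGe S} (h : Homotopic p q) : Homotopic p.inv q.inv := by
  obtain ⟨k, h1, h2, h3, h4, h5, h6⟩ := homotopic_iff.1 h
  exact homotopic_iff.2 ⟨_, h1.symm, h2.symm,
    fun t ht => Contactomorphism.inv_congr (h3 t ht),
    fun t ht => Contactomorphism.inv_congr (h4 t ht),
    fun t ht x => Contactomorphism.inv_eq_of_apply_eq (h5 t ht x),
    fun t ht => Contactomorphism.inv_congr (h6 t ht)⟩

/-- The time change is joined to the identity by linear interpolation. Convexity keeps all times in
`[0, 1]`, the only range where the path is controlled at infinity. -/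
theorem Homotopic.reparam (p : PathGe S) (β : ℝ → ℝ) (hβ : ContDiff ℝ ∞ β)
    (hI : MapsTo β (Icc 0 1) (Icc 0 1)) (h0 : β 0 = 0) (h1 : β 1 = 1) :
    Homotopic p (p.reparam β hβ hI h0) := by
  have hσ : ContDiff ℝ ∞ (fun y : ℝ × ℝ => (1 - y.1) * y.2 + y.1 * β y.2) :=
    ((contDiff_const.sub contDiff_fst).mul contDiff_snd).add
      (contDiff_fst.mul (hβ.comp contDiff_snd))
  refine homotopic_iff.2 ⟨_, p.smoothFamily.reparam hσ, p.isFlowAtInfinity.reparam hσ ?_,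
    ?_, ?_, ?_, ?_⟩
  · rintro ⟨u, t⟩ ⟨hu, ht⟩
    exact convex_Icc (0 : ℝ) 1 ht (hI ht) (sub_nonneg.2 hu.2) hu.1 (by ring)
  · intro t _ x; simp
  · intro t _ x; simp
  · intro u _ x; simp [h0, p.map_zero]
  · intro u _ x; simp [h1]

namespace PathGe

theorem toCover_eq_of_eqOn {p q : PathGe S}
    (h : ∀ t ∈ Icc (0 : ℝ) 1, ∀ x, p.map t x = q.map t x) : p.toCover = q.toCover :=
  Quot.sound (.of_eqOn h)

/-- Equality of classes is equality in a bare `Quot`, so it is used by descending functions to the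
quotient rather than by extracting a homotopy. -/
theorem map_one_eq_of_toCover_eq {p q : PathGe S} (h : p.toCover = q.toCover) (x : V) :
    p.map 1 x = q.map 1 x :=
  congrArg (Quot.lift (fun p : PathGe S => p.map 1 x) fun _ _ h => Homotopic.map_one h x) h

theorem toCover_mul_congr {p p' q q' : PathGe S} (h : p.toCover = p'.toCover)
    (h' : q.toCover = q'.toCover) : (p.mul q).toCover = (p'.mul q').toCover := by
  have hl := congrArg (Quot.map (fun p : PathGe S => p.mul q)
    fun _ _ h => h.mul (.of_eqOn fun _ _ _ => rfl)) h
  have hr := congrArg (Quot.map (fun q : PathGe S => p'.mul q)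
    fun _ _ h => Homotopic.mul (.of_eqOn fun _ _ _ => rfl) h) h'
  exact hl.trans hr

theorem toCover_inv_congr {p p' : PathGe S} (h : p.toCover = p'.toCover) :
    p.inv.toCover = p'.inv.toCover :=
  congrArg (Quot.map PathGe.inv fun _ _ h => Homotopic.inv h) h

theorem toCover_reparam (p : PathGe S) (β : ℝ → ℝ) (hβ : ContDiff ℝ ∞ β)
    (hI : MapsTo β (Icc 0 1) (Icc 0 1)) (h0 : β 0 = 0) (h1 : β 1 = 1) :
    (p.reparam β hβ hI h0).toCover = p.toCover :=
  (Quot.sound (Homotopic.reparam p β hβ hI h0 h1)).symm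

end PathGe

/-- The velocity of the curve `τ ↦ p_τ(y)` at time `t`. -/
def ContactIsotopy.velocity (p : ContactIsotopy α) (t : ℝ) (y : V) :
    TangentSpace (𝓡 (2 * n + 1)) (p.map t y) :=
  mfderiv 𝓘(ℝ, ℝ) (𝓡 (2 * n + 1)) (fun τ => p.map τ y) t (1 : ℝ)

/-- The value of the contact form on the velocity of the curve `τ ↦ p_τ(y)` at time `t`. -/
def ContactIsotopy.speed (p : ContactIsotopy α) (t : ℝ) (y : V) : ℝ :=
  α.form (p.map t y) (p.velocity t y)

/-! ### Calculus of contact Hamiltonians -/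

namespace ContactIsotopy

theorem hamiltonian_eq (p : ContactIsotopy α) (t : ℝ) (z : Symplectization V) :
    p.hamiltonian t z = z.2 * p.speed t ((p.map t).inv z.1) := rfl

theorem hamiltonian_lift (p : ContactIsotopy α) (t : ℝ) (z : Symplectization V) :
    p.hamiltonian t ((p.map t).lift z) = z.2 / (p.map t).factor z.1 * p.speed t z.1 := by
  rw [hamiltonian_eq]
  simp only [Contactomorphism.lift, Contactomorphism.inv_apply]

theorem mdifferentiableAt_curve (p : ContactIsotopy α) (t : ℝ) (y : V) :
    MDifferentiableAt 𝓘(ℝ, ℝ) (𝓡 (2 * n + 1)) (fun τ => p.map τ y) t :=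
  (p.smooth.comp (contMDiff_id.prodMk contMDiff_const)).mdifferentiable (by simp) t

theorem speed_congr {p q : ContactIsotopy α} {t : ℝ} {y : V}
    (h : ∀ᶠ τ in 𝓝 t, p.map τ y = q.map τ y) : p.speed t y = q.speed t y := by
  have key : ∀ (x x' : V) (w w' : ContactModel n), x = x' → w = w' →
      α.form x w = α.form x' w' := by
    rintro _ _ _ _ rfl rfl
    rfl
  refine key _ _ _ _ h.self_of_nhds ?_
  exact congrArg (fun L : ℝ →L[ℝ] ContactModel n => L 1) (Filter.EventuallyEq.mfderiv_eq h)

/-- The contact isotopy given by a smooth family of contactomorphisms. -/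
def ofFamily (k : ℝ → Contactomorphism α) (hk : SmoothFamily k) : ContactIsotopy α :=
  ⟨k, hk.smooth, hk.smooth_inv⟩

theorem smoothFamily (p : ContactIsotopy α) : SmoothFamily p.map := ⟨p.smooth, p.smooth_inv⟩

/-- The pointwise composition of two contact isotopies. -/
def comp (p q : ContactIsotopy α) : ContactIsotopy α :=
  ofFamily _ (p.smoothFamily.comp q.smoothFamily)

/-- The pointwise inverse of a contact isotopy. -/
def symm (p : ContactIsotopy α) : ContactIsotopy α :=
  ofFamily _ p.smoothFamily.symm

/-- The contact isotopy `t ↦ p_{β(t)}`. -/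
def reparam (p : ContactIsotopy α) (β : ℝ → ℝ) (hβ : ContDiff ℝ ∞ β) : ContactIsotopy α :=
  ofFamily _ (p.smoothFamily.reparam hβ)

/-- The velocity of `p_t q_t` splits into that of `p` and the image under `dp_t` of that of `q`; the
contact form scales the second term by the conformal factor of `p_t`. -/
theorem speed_comp (p q : ContactIsotopy α) (t : ℝ) (y : V) : (p.comp q).speed t y =
    p.speed t (q.map t y) + (p.map t).factor (q.map t y) * q.speed t y := by
  have hG : MDifferentiableAt (𝓘(ℝ, ℝ).prod (𝓡 (2 * n + 1))) (𝓡 (2 * n + 1))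
      (fun r : ℝ × V => p.map r.1 r.2) (t, q.map t y) :=
    p.smooth.mdifferentiable (by simp) _
  have hq := q.mdifferentiableAt_curve t y
  have h1 := (HasMFDerivAt.comp t hG.hasMFDerivAt
    ((hasMFDerivAt_id t).prodMk hq.hasMFDerivAt)).mfderiv
  have h2 : (p.comp q).velocity t y = p.velocity t (q.map t y) +
      mfderiv (𝓡 (2 * n + 1)) (𝓡 (2 * n + 1)) (p.map t) (q.map t y) (q.velocity t y) :=
    (congrArg (fun L : ℝ →L[ℝ] ContactModel n => L 1) h1).trans
      (mfderiv_prod_eq_add_apply (p := (t, q.map t y))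
        (v := (⟨1, q.velocity t y⟩ : ℝ × ContactModel n)) hG)
  have h3 := (p.map t).form_mfderiv (q.map t y) (q.velocity t y)
  refine (congrArg (α.form (p.map t (q.map t y))) h2).trans ?_
  rw [map_add]
  exact congrArg _ h3

theorem speed_reparam (p : ContactIsotopy α) (β : ℝ → ℝ) (hβ : ContDiff ℝ ∞ β) (t : ℝ) (y : V) :
    (p.reparam β hβ).speed t y = deriv β t * p.speed (β t) y := by
  have hd : HasDerivAt β (deriv β t) t := (hβ.differentiable (by simp) t).hasDerivAt
  have h2 : (p.reparam β hβ).velocity t y = deriv β t • p.velocity (β t) y :=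
    velocity_comp (p.mdifferentiableAt_curve (β t) y) hd
  refine (congrArg (α.form (p.map (β t) y)) h2).trans ?_
  rw [map_smul, smul_eq_mul]
  rfl

end ContactIsotopy

namespace PathGe

theorem speed_mul (p q : PathGe S) (t : ℝ) (y : V) : (p.mul q).speed t y =
    p.speed t (q.map t y) + (p.map t).factor (q.map t y) * q.speed t y :=
  p.speed_comp q.toContactIsotopy t y

theorem speed_reparam (p : PathGe S) (β : ℝ → ℝ) (hβ : ContDiff ℝ ∞ β)
    (hI : MapsTo β (Icc 0 1) (Icc 0 1)) (h0 : β 0 = 0) (t : ℝ) (y : V) :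
    (p.reparam β hβ hI h0).speed t y = deriv β t * p.speed (β t) y :=
  p.toContactIsotopy.speed_reparam β hβ t y

theorem speed_reebPath (c t : ℝ) (y : V) : (reebPath S c).speed t y = c := by
  have hf : MDifferentiableAt 𝓘(ℝ, ℝ) (𝓡 (2 * n + 1)) (fun τ => S.flow τ y) (c * t) :=
    (S.integral y (c * t)).mdifferentiableAt
  have hd : HasDerivAt (fun τ : ℝ => c * τ) c t := by simpa using (hasDerivAt_id t).const_mul c
  have h1 := mfderiv_comp_apply t hf hd.differentiableAt.mdifferentiableAt (1 : ℝ)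
  have h2 : (reebPath S c).velocity t y = c • S.reeb (S.flow (c * t) y) :=
    (velocity_comp hf hd).trans (congrArg (c • ·) (S.velocity _ y))
  refine (congrArg (α.form (S.flow (c * t) y)) h2).trans ?_
  rw [map_smul, S.form_reeb, smul_eq_mul, mul_one]

end PathGe

/-! ### A contact isotopy is determined by its Hamiltonian -/

namespace ContactIsotopy

/-- A contact isotopy with vanishing contact Hamiltonian has zero velocity. -/
theorem velocity_eq_zero (p : ContactIsotopy α) (h : ∀ t y, p.speed t y = 0) (t : ℝ) (y : V) :
    p.velocity t y = 0 := by
  refine α.nondegenerate _ _ (h t y) fun w hw => ?_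
  -- Every test vector in the contact hyperplane is `dp_t v` with `α(v) = 0`. Then `α(dp_τ v)`
  -- vanishes for all `τ`, while Cartan's formula gives its derivative as `dα` of the velocity
  -- against `dp_t v`.
  obtain ⟨v, rfl⟩ : ∃ v : TangentSpace (𝓡 (2 * n + 1)) y,
      mfderiv (𝓡 (2 * n + 1)) (𝓡 (2 * n + 1)) (p.map t) y v = w := by
    let e := (p.map t).toDiffeomorph.mfderivToContinuousLinearEquiv (x := y) (by simp)
    exact e.surjective w
  have hv : α.form y v = 0 := by
    have h1 := ((p.map t).form_mfderiv y v).symm.trans hw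
    exact (mul_eq_zero.1 h1).resolve_left ((p.map t).factor_pos y).ne'
  have h2 := hasDerivAt_pullback α (fun t => p.map t) p.smooth t y v 0 (h t)
  refine h2.unique ((hasDerivAt_const t (0 : ℝ)).congr_of_eventuallyEq (.of_forall fun τ => ?_))
  refine ((p.map τ).form_mfderiv y v).trans ?_
  rw [hv, mul_zero]

theorem map_eq_of_speed_eq_zero [T2Space V] (p : ContactIsotopy α)
    (h : ∀ t y, p.speed t y = 0) (t : ℝ) (y : V) : p.map t y = p.map 0 y := by
  have hγ : IsMIntegralCurve (I := 𝓡 (2 * n + 1)) (fun τ => p.map τ y) (fun _ => 0) := by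
    intro τ
    have h1 := (p.mdifferentiableAt_curve τ y).hasMFDerivAt
    have h2 : mfderiv 𝓘(ℝ, ℝ) (𝓡 (2 * n + 1)) (fun τ => p.map τ y) τ =
        ContinuousLinearMap.smulRight (1 : ℝ →L[ℝ] ℝ) (0 : ContactModel n) := by
      refine ContinuousLinearMap.ext_ring ?_
      exact (p.velocity_eq_zero h τ y).trans (smul_zero (1 : ℝ)).symm
    rwa [h2] at h1
  have hγ' : IsMIntegralCurve (I := 𝓡 (2 * n + 1)) (fun _ : ℝ => p.map 0 y) (fun _ => 0) := by
    intro τ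
    have h1 := hasMFDerivAt_const (I := 𝓘(ℝ, ℝ)) (I' := 𝓡 (2 * n + 1)) (p.map 0 y) τ
    have h2 : (0 : ℝ →L[ℝ] ContactModel n) =
        ContinuousLinearMap.smulRight (1 : ℝ →L[ℝ] ℝ) (0 : ContactModel n) := by simp
    exact h2 ▸ h1
  have hv : ContMDiff (𝓡 (2 * n + 1)) (𝓡 (2 * n + 1)).tangent 1
      (fun x : V => (⟨x, 0⟩ : TangentBundle (𝓡 (2 * n + 1)) V)) :=
    Bundle.contMDiff_zeroSection ℝ (TangentSpace (𝓡 (2 * n + 1)) : V → Type _)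
  have : IsManifold (𝓡 (2 * n + 1)) 1 V := IsManifold.of_le (n := ∞) (by simp)
  -- Each trajectory and the constant curve are integral curves of the zero field; uniqueness on a
  -- Hausdorff manifold identifies them.
  exact congrFun (isMIntegralCurve_Ioo_eq_of_contMDiff_boundaryless (t₀ := 0) hv hγ hγ' rfl) t

/-- If the contact Hamiltonian of a contact isotopy starting at the identity is 1-periodic in time,
then `p_{t+1} = p_t ∘ p_1`. -/
theorem map_add_one_of_periodic [T2Space V] (p : ContactIsotopy α) (h0 : ∀ x, p.map 0 x = x)
    (h : ∀ t z, p.hamiltonian (t + 1) z = p.hamiltonian t z) (t : ℝ) (x : V) :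
    p.map (t + 1) x = p.map t (p.map 1 x) := by
  have hs : ∀ t y, p.speed (t + 1) ((p.map (t + 1)).inv y) = p.speed t ((p.map t).inv y) := by
    intro t y
    have h1 := h t (y, ⟨1, mem_Ioi.2 one_pos⟩)
    simpa [hamiltonian_eq] using h1
  have hshift : ContDiff ℝ ∞ (fun τ : ℝ => τ + 1) := contDiff_id.add contDiff_const
  -- The isotopies `q_t = p_t p_1` and `r_t = p_{t+1}` have the same Hamiltonian, so `d = q⁻¹ r`
  -- should be constant.
  let q := p.comp (p.reparam (fun _ => 1) contDiff_const)
  let r := p.reparam (fun τ => τ + 1) hshift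
  let d := q.symm.comp r
  have hd : ∀ t y, d.map t y = (p.map 1).inv ((p.map t).inv (p.map (t + 1) y)) :=
    fun _ _ => rfl
  have hr : ∀ t y, r.speed t y = p.speed (t + 1) y := by
    intro t y
    rw [speed_reparam, deriv_add_const, deriv_id'', one_mul]
  have hq : ∀ t y, q.speed t y = p.speed t (p.map 1 y) := by
    intro t y
    rw [speed_comp, speed_reparam, deriv_const, zero_mul, mul_zero, add_zero]
    rfl
  -- The product rule applied to `r = q d` leaves a positive factor times the speed of `d` equal to
  -- zero.
  have hz : ∀ t y, d.speed t y = 0 := by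
    intro t y
    have h1 : (q.comp d).speed t y = r.speed t y :=
      speed_congr (.of_forall fun τ => (q.map τ).apply_inv (r.map τ y))
    rw [speed_comp, hr, hq, hd, Contactomorphism.apply_inv, ← hs, Contactomorphism.inv_apply,
      add_eq_left] at h1
    exact (mul_eq_zero.1 h1).resolve_left ((q.map t).factor_pos _).ne'
  have h2 := d.map_eq_of_speed_eq_zero hz t x
  have h3 : d.map 0 x = x := by
    rw [hd, Contactomorphism.inv_eq_of_apply_eq (h0 _), zero_add, Contactomorphism.inv_apply]
  rw [h3, hd] at h2
  rw [← h2, Contactomorphism.apply_inv, Contactomorphism.apply_inv, h2]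

end ContactIsotopy

/-! ### Smooth periodic extension of paths with matching end germs -/

theorem eventually_map_fract_eq {X : Type*} {ψ : ℝ → X} {ε : ℝ} (hε : 0 < ε)
    (hψ : ∀ t, |t| < ε → ψ (t + 1) = ψ t) (t₀ : ℝ) :
    ∀ᶠ t in 𝓝 t₀, ψ (Int.fract t) = ψ (t - ⌊t₀⌋) := by
  rcases (Int.floor_le t₀).eq_or_lt with h0 | h0
  · have h1 : Ioo (t₀ - min ε 1) (t₀ + min ε 1) ∈ 𝓝 t₀ :=
      Ioo_mem_nhds (by simpa using hε) (by simpa using hε)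
    filter_upwards [h1] with t ht
    have h2 : t - t₀ < min ε 1 := by linarith [ht.2]
    have h3 : -min ε 1 < t - t₀ := by linarith [ht.1]
    have h4 := min_le_left ε 1
    have h5 := min_le_right ε 1
    rcases le_or_gt t₀ t with h6 | h6
    · have : ⌊t⌋ = ⌊t₀⌋ := Int.floor_eq_iff.2 ⟨by linarith, by linarith⟩
      rw [Int.fract, this]
    -- Just to the left of an integer the floor drops by one; agreement of the germs at `0` and `1`
    -- absorbs the jump.
    · have : ⌊t⌋ = ⌊t₀⌋ - 1 := by
        refine Int.floor_eq_iff.2 ⟨?_, ?_⟩ <;> push_cast <;> linarith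
      rw [Int.fract, this, ← hψ (t - ⌊t₀⌋) (abs_lt.2 ⟨by linarith, by linarith⟩)]
      push_cast
      congr 1
      ring
  · filter_upwards [Ioo_mem_nhds h0 (Int.lt_floor_add_one t₀)] with t ht
    have : ⌊t⌋ = ⌊t₀⌋ := Int.floor_eq_iff.2 ⟨ht.1.le, ht.2⟩
    rw [Int.fract, this]

theorem SmoothFamily.comp_fract {k : ℝ → Contactomorphism α} (hk : SmoothFamily k) {ε : ℝ}
    (hε : 0 < ε) (hp : ∀ t, |t| < ε → ∀ x, k (t + 1) x = k t x) :
    SmoothFamily (fun t => k (Int.fract t)) := by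
  have hshift : ∀ t₀ : ℝ, ContDiff ℝ ∞ (fun t : ℝ => t - ⌊t₀⌋) := fun t₀ =>
    contDiff_id.sub contDiff_const
  constructor
  · rintro ⟨t₀, x₀⟩
    refine ((hk.reparam (hshift t₀)).smooth _).congr_of_eventuallyEq ?_
    have h1 := eventually_map_fract_eq (ψ := fun t x => k t x) hε (fun t ht => funext (hp t ht)) t₀
    filter_upwards [continuous_fst.continuousAt.eventually h1] with q hq
    exact congrFun hq q.2
  · rintro ⟨t₀, x₀⟩
    refine ((hk.reparam (hshift t₀)).smooth_inv _).congr_of_eventuallyEq ?_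
    have h1 := eventually_map_fract_eq (ψ := fun t x => (k t).inv x) hε
      (fun t ht => funext (Contactomorphism.inv_congr (hp t ht))) t₀
    filter_upwards [continuous_fst.continuousAt.eventually h1] with q hq
    exact congrFun hq q.2

namespace PathGe

theorem map_one_of_periodic_near_zero (p : PathGe S) {ε : ℝ} (hε : 0 < ε)
    (hp : ∀ t, |t| < ε → ∀ x, p.map (t + 1) x = p.map t x) (x : V) : p.map 1 x = x := by
  have h := hp 0 (by simpa using hε) x
  rwa [zero_add, p.map_zero] at h

theorem map_fract_of_periodic_near_zero (p : PathGe S) {ε : ℝ} (hε : 0 < ε)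
    (hp : ∀ t, |t| < ε → ∀ x, p.map (t + 1) x = p.map t x) {t : ℝ} (ht : t ∈ Icc (0 : ℝ) 1)
    (x : V) : p.map (Int.fract t) x = p.map t x := by
  rcases ht.2.eq_or_lt with rfl | h1
  · rw [Int.fract_one, p.map_zero, p.map_one_of_periodic_near_zero hε hp]
  · rw [Int.fract_eq_self.2 ⟨ht.1, h1⟩]

section Loop

variable (p : PathGe S) {ε : ℝ} (hε : 0 < ε)
  (hp : ∀ t, |t| < ε → ∀ x, p.map (t + 1) x = p.map t x)

/-- The 1-periodic extension of the restriction of a path to `[0, 1]`, for a path whose germs at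
times `0` and `1` agree. -/
def loop : PathGe S :=
  ofFamily (fun t => p.map (Int.fract t)) (p.smoothFamily.comp_fract hε hp)
    (by
      obtain ⟨c, hc, K, hK, h⟩ := p.isFlowAtInfinity
      -- The function `c` need not be made periodic: only `[0, 1]` matters, and there the extension
      -- equals `p`, even at time `1` since `p_1 = id`.
      refine ⟨c, hc, K, hK, fun t ht x hx => ?_⟩
      rw [p.map_fract_of_periodic_near_zero hε hp ht, h t ht x hx])
    (fun x => by rw [Int.fract_zero, p.map_zero])

theorem loop_map (t : ℝ) : (p.loop hε hp).map t = p.map (Int.fract t) := rfl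

theorem isLoop_loop : (p.loop hε hp).IsLoop := fun t x => by
  rw [loop_map, loop_map, Int.fract_add_one]

theorem toCover_loop : (p.loop hε hp).toCover = p.toCover :=
  toCover_eq_of_eqOn fun _ ht x => p.map_fract_of_periodic_near_zero hε hp ht x

theorem speed_loop {t : ℝ} (ht : t ∈ Ico (0 : ℝ) 1) (y : V) :
    (p.loop hε hp).speed t y = p.speed t y := by
  refine ContactIsotopy.speed_congr ?_
  have h1 := eventually_map_fract_eq (ψ := fun t x => p.map t x) hε (fun t ht => funext (hp t ht)) t
  filter_upwards [h1] with τ hτ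
  have h2 := congrFun hτ y
  rwa [Int.floor_eq_zero_iff.2 ht, Int.cast_zero, sub_zero] at h2

end Loop

end PathGe

/-! ### Non-negative paths made constant near their ends -/

/-- A smooth step function: `0` for `t ≤ 1/3` and `1` for `t ≥ 2/3`. -/
def smoothStep (t : ℝ) : ℝ := Real.smoothTransition (3 * t - 1)

theorem contDiff_smoothStep : ContDiff ℝ ∞ smoothStep :=
  Real.smoothTransition.contDiff.comp ((contDiff_const.mul contDiff_id).sub contDiff_const)

theorem smoothStep_mem (t : ℝ) : smoothStep t ∈ Icc (0 : ℝ) 1 :=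
  ⟨Real.smoothTransition.nonneg _, Real.smoothTransition.le_one _⟩

theorem smoothStep_of_le {t : ℝ} (ht : t ≤ 1 / 3) : smoothStep t = 0 :=
  Real.smoothTransition.zero_of_nonpos (by linarith)

theorem smoothStep_of_ge {t : ℝ} (ht : 2 / 3 ≤ t) : smoothStep t = 1 :=
  Real.smoothTransition.one_of_one_le (by linarith)

theorem deriv_smoothStep_nonneg (t : ℝ) : 0 ≤ deriv smoothStep t := by
  have h : Monotone smoothStep := fun a b hab =>
    Real.smoothTransition.monotone (by linarith)
  exact h.deriv_nonneg

/-- The path `h` run through during the time interval `[1/3, 2/3]`. -/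
def PathGe.step (h : PathGe S) : PathGe S :=
  h.reparam smoothStep contDiff_smoothStep (fun t _ => smoothStep_mem t)
    (smoothStep_of_le (by norm_num))

@[simp]
theorem PathGe.step_map (h : PathGe S) (t : ℝ) : h.step.map t = h.map (smoothStep t) := rfl

theorem PathGe.toCover_step (h : PathGe S) : h.step.toCover = h.toCover :=
  h.toCover_reparam _ _ _ _ (smoothStep_of_ge (by norm_num))

theorem PathGe.speed_step_nonneg {h : PathGe S}
    (hh : ∀ t ∈ Icc (0 : ℝ) 1, ∀ z, 0 ≤ h.hamiltonian t z) (t : ℝ) (x : V) :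
    0 ≤ h.step.speed t x := by
  have h1 := hh _ (smoothStep_mem t) (h.map (smoothStep t) x, ⟨1, mem_Ioi.2 one_pos⟩)
  rw [ContactIsotopy.hamiltonian_eq] at h1
  simp only [Contactomorphism.inv_apply, one_mul] at h1
  exact (h.speed_reparam _ _ _ _ t x).symm ▸ mul_nonneg (deriv_smoothStep_nonneg t) h1

/-- If `p_t` and `q_t` are compactly supported paths with the same end point, then
`e_{-mt} p_t e_{mt} q_t⁻¹` is a loop of compactly supported contactomorphisms. -/
theorem PathGe.representsPi_of_toCover_eq {φ p q : PathGe S} {m : ℤ}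
    (hp : p.IsCompactlySupported) (hq : q.IsCompactlySupported)
    (h1 : ∀ x, p.map 1 x = q.map 1 x)
    (hφ : φ.toCover =
      ((reebPath S (-m)).mul (p.mul ((reebPath S m).mul q.inv))).toCover) :
    φ.RepresentsPi := by
  refine ⟨_, ?_, ?_, hφ⟩
  · obtain ⟨K, hK, hpK⟩ := hp
    obtain ⟨L, hL, hqL⟩ := hq
    -- Conjugation by `e_{mt}` moves the support of `p_t` only within the Reeb saturation of `K`.
    refine ⟨S.saturation K ∪ L, (S.isCompact_saturation hK).union hL, fun t ht x hx => ?_⟩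
    rw [mem_union, not_or] at hx
    simp only [mul_map, inv_map, reebPath_map]
    rw [Contactomorphism.inv_eq_of_apply_eq (hqL t ht x hx.2), hpK t ht _ (S.flow_notMem hx.1 _),
      ← S.flow_add, neg_mul, neg_add_cancel, S.flow_zero]
  · intro x
    simp only [mul_map, inv_map, reebPath_map, mul_one]
    rw [S.flow_int, ← Int.cast_neg, S.flow_int, h1, Contactomorphism.apply_inv]

/-! ### The intersection argument -/

theorem le_of_succeq_reebPath [T2Space V] {A B : Set (Symplectization V)}
    (hAB : StrongStableIntersection S A B) (hB : ∀ t : ℝ, MapsTo (S.contactFlow t).lift B B)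
    {c : ℝ} {f g : PathGe S} (hf : f.toCover ∈ coverGc S)
    (hperiodic : ∀ t z, f.hamiltonian (t + 1) z = f.hamiltonian t z)
    (hF : ∀ t : ℝ, ∀ z ∈ B, c * (z.2 : ℝ) < f.hamiltonian t z)
    (hg : g.IsCompactlySupported) (hgf : ∀ x, g.map 1 x = f.map 1 x) {m : ℤ}
    (hm : Succeq (reebPath S m).toCover g.toCover) : c ≤ m := by
  by_contra! hlt
  obtain ⟨p, hp, hpf⟩ := hf
  obtain ⟨f₀, g₀, k₀, hf₀, hg₀, hk, h, hhk, hpos⟩ := hm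
  -- The path `h` lies in the class `e^m g⁻¹`, with `e_m = id` and `g_1 = f_1`, so it ends at
  -- `f_1⁻¹`.
  have hh1 : ∀ x, f.map 1 (h.map 1 x) = x := by
    intro x
    have e1 := hk 1 ((f.map 1).inv x)
    rw [PathGe.map_one_eq_of_toCover_eq hf₀, PathGe.map_one_eq_of_toCover_eq hg₀, hgf,
      Contactomorphism.apply_inv, ← PathGe.map_one_eq_of_toCover_eq hhk, reebPath_map, mul_one,
      S.flow_int] at e1
    rw [e1, Contactomorphism.apply_inv]
  set ψ : PathGe S := (reebPath S (-m)).mul (f.mul h.step) with hψ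
  have hψper : ∀ t, |t| < 1 / 3 → ∀ x, ψ.map (t + 1) x = ψ.map t x := by
    intro t ht x
    obtain ⟨ht1, ht2⟩ := abs_lt.1 ht
    simp only [hψ, PathGe.mul_map, PathGe.step_map, reebPath_map]
    -- Near time `0` the factor `h` is the identity, and near time `1` it is `f_1⁻¹`, which cancels
    -- the `f_1` in `f_{t+1} = f_t f_1`.
    rw [smoothStep_of_ge (by linarith), smoothStep_of_le ht2.le, h.map_zero,
      f.map_add_one_of_periodic f.map_zero hperiodic, hh1, mul_add, mul_one, S.flow_add,
      ← Int.cast_neg, S.flow_int]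
  have hε : (0 : ℝ) < 1 / 3 := by norm_num
  have hk₀ : k₀.toCover = ((reebPath S m).mul g.inv).toCover := by
    have e1 : k₀.toCover = (f₀.mul g₀.inv).toCover := by
      refine PathGe.toCover_eq_of_eqOn fun t _ x => ?_
      rw [PathGe.mul_map, PathGe.inv_map, ← hk, Contactomorphism.apply_inv]
    exact e1.trans (PathGe.toCover_mul_congr hf₀ (PathGe.toCover_inv_congr hg₀))
  -- In the cover, `f` may be replaced by the compactly supported `p`, and `h` by `e^m g⁻¹`.
  have hPi : (ψ.loop hε hψper).RepresentsPi := by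
    refine PathGe.representsPi_of_toCover_eq (m := m) hp hg ?_
      ((ψ.toCover_loop hε hψper).trans ?_)
    · intro x
      rw [hgf, PathGe.map_one_eq_of_toCover_eq hpf]
    · exact PathGe.toCover_mul_congr rfl
        (PathGe.toCover_mul_congr hpf.symm (h.toCover_step.trans (hhk.trans hk₀)))
  obtain ⟨_, ⟨⟨z, r, θ⟩, ⟨-, hr⟩, rfl⟩, hwB, hw0⟩ := hAB.2 _ (ψ.isLoop_loop hε hψper) hPi
  -- The suspension uses the representative in `[0, 1)`, where the loop has the same maps and speed
  -- as `ψ`. Both `r`-coordinates are zero, so the Hamiltonian vanishes at the intersection point.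
  obtain ⟨τ, hτ, hτθ⟩ : ∃ τ ∈ Ico (0 : ℝ) 1, (AddCircle.equivIco (1 : ℝ) 0 θ : ℝ) = τ :=
    ⟨_, by simpa using (AddCircle.equivIco (1 : ℝ) 0 θ).2, rfl⟩
  simp only [PathGe.suspension, hτθ] at hwB hw0 hr
  rw [hr, zero_sub, neg_eq_zero, ContactIsotopy.hamiltonian_lift, ψ.speed_loop hε hψper hτ] at hw0
  rw [PathGe.loop_map, Int.fract_eq_self.2 hτ] at hwB hw0
  have hs : 0 < (z.2 : ℝ) / (ψ.map τ).factor z.1 := div_pos z.2.2 ((ψ.map τ).factor_pos _)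
  have hψ0 : ψ.speed τ z.1 = 0 := (mul_eq_zero.1 hw0).resolve_left hs.ne'
  -- Invariance of `B` undoes the factor `e_{-mτ}`: the point over `f_τ h_τ(z)`, with `h`
  -- reparametrized, is still in `B`.
  have hf1 : c < f.speed τ (h.step.map τ z.1) := by
    have e1 := hF τ _ (hB (m * τ) hwB)
    rw [ContactIsotopy.hamiltonian_eq] at e1
    have e2 : ((S.contactFlow (m * τ)).lift ((ψ.map τ).lift z)).1 =
        f.map τ (h.step.map τ z.1) := by
      change S.flow (m * τ) (S.flow (-m * τ) _) = _
      rw [neg_mul, S.flow_flow_neg]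
      rfl
    rw [e2, Contactomorphism.inv_apply, mul_comm] at e1
    exact lt_of_mul_lt_mul_left e1
      ((S.contactFlow (m * τ)).lift ((ψ.map τ).lift z)).2.2.le
  -- The factor `1` is the conformal factor of the Reeb flow.
  have hψ1 : ψ.speed τ z.1 = -m + 1 * (f.speed τ (h.step.map τ z.1) +
      (f.map τ).factor (h.step.map τ z.1) * h.step.speed τ z.1) := by
    rw [hψ, PathGe.speed_mul, PathGe.speed_mul, PathGe.speed_reebPath]
    rfl
  have hh2 := mul_nonneg ((f.map τ).factor_pos (h.step.map τ z.1)).le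
    (PathGe.speed_step_nonneg hpos τ z.1)
  linarith

/-! ### Bounded speed and existence of upper bounds `e^m` -/

namespace ContactIsotopy

/-- The velocity is the tangent map of `(t, x) ↦ p_t(x)` evaluated on the continuous field `(1, 0)`,
and the contact form is a continuous bundle section. -/
theorem continuous_speed (p : ContactIsotopy α) :
    Continuous (fun q : ℝ × V => p.speed q.1 q.2) := by
  have : IsManifold (𝓡 (2 * n + 1)) 1 V := IsManifold.of_le (n := ∞) (by simp)
  have h1 : ContMDiff (𝓘(ℝ, ℝ).prod (𝓡 (2 * n + 1))).tangent (𝓡 (2 * n + 1)).tangent 0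
      (tangentMap (𝓘(ℝ, ℝ).prod (𝓡 (2 * n + 1))) (𝓡 (2 * n + 1))
        (fun q : ℝ × V => p.map q.1 q.2)) :=
    p.smooth.contMDiff_tangentMap (by simp)
  have h2 : ContMDiff 𝓘(ℝ, ℝ) 𝓘(ℝ, ℝ).tangent 0
      (fun t : ℝ => (⟨t, (1 : ℝ)⟩ : TangentBundle 𝓘(ℝ, ℝ) ℝ)) :=
    contMDiff_vectorSpace_iff_contDiff.2 contDiff_const
  have h3 : ContMDiff (𝓡 (2 * n + 1)) (𝓡 (2 * n + 1)).tangent 0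
      (fun x : V => (⟨x, 0⟩ : TangentBundle (𝓡 (2 * n + 1)) V)) :=
    Bundle.contMDiff_zeroSection ℝ (TangentSpace (𝓡 (2 * n + 1)) : V → Type _)
  have h4 := h1.comp (contMDiff_equivTangentBundleProd_symm.comp
    ((h2.comp contMDiff_fst).prodMk (h3.comp contMDiff_snd)))
  have h5 : ContMDiff (𝓘(ℝ, ℝ).prod (𝓡 (2 * n + 1))) (𝓡 (2 * n + 1)).tangent 0
      (fun q : ℝ × V =>
        (⟨p.map q.1 q.2, p.velocity q.1 q.2⟩ : TangentBundle (𝓡 (2 * n + 1)) V)) := by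
    refine h4.congr fun q => ?_
    have hG : MDifferentiableAt (𝓘(ℝ, ℝ).prod (𝓡 (2 * n + 1))) (𝓡 (2 * n + 1))
        (fun r : ℝ × V => p.map r.1 r.2) q := p.smooth.mdifferentiable (by simp) _
    have h6 := mfderiv_prod_eq_add_apply (p := q) (v := (⟨1, 0⟩ : ℝ × ContactModel n)) hG
    refine congrArg (fun w : ContactModel n =>
      (⟨p.map q.1 q.2, w⟩ : TangentBundle (𝓡 (2 * n + 1)) V)) (Eq.trans ?_ h6.symm)
    exact ((congrArg (fun w : ContactModel n => (show ContactModel n from p.velocity q.1 q.2) + w)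
      (map_zero (mfderiv (𝓡 (2 * n + 1)) (𝓡 (2 * n + 1)) (p.map q.1) q.2))).trans
        (add_zero _)).symm
  have h7 := (α.smooth.of_le (m := 0) (by simp)).comp (p.smooth.of_le (m := 0) (by simp))
  have h8 := ContMDiff.clm_bundle_apply (E₂ := Bundle.Trivial V ℝ) h7 h5
  refine continuous_iff_continuousAt.2 fun q => ?_
  exact (Bundle.contMDiffAt_totalSpace.1 (h8 q)).2.continuousAt

end ContactIsotopy

namespace PathGe

theorem IsCompactlySupported.inv {p : PathGe S} (hp : p.IsCompactlySupported) :
    p.inv.IsCompactlySupported := by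
  obtain ⟨K, hK, h⟩ := hp
  exact ⟨K, hK, fun t ht x hx => Contactomorphism.inv_eq_of_apply_eq (h t ht x hx)⟩

theorem speed_eq_zero_of_forall_map_eq (p : PathGe S) {y : V}
    (h : ∀ t ∈ Icc (0 : ℝ) 1, p.map t y = y) {t : ℝ} (ht : t ∈ Icc (0 : ℝ) 1) :
    p.speed t y = 0 := by
  -- Nothing is assumed outside `[0, 1]`, so at the end points the velocity is computed as a
  -- one-sided derivative.
  have hu : UniqueMDiffWithinAt 𝓘(ℝ, ℝ) (Icc (0 : ℝ) 1) t :=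
    uniqueMDiffWithinAt_iff_uniqueDiffWithinAt.2 (uniqueDiffOn_Icc_zero_one t ht)
  have h1 := mfderivWithin_eq_mfderiv hu (p.mdifferentiableAt_curve t y)
  have h2 : HasMFDerivWithinAt 𝓘(ℝ, ℝ) (𝓡 (2 * n + 1)) (fun τ => p.map τ y) (Icc (0 : ℝ) 1) t
      (0 : ℝ →L[ℝ] ContactModel n) :=
    (hasMFDerivWithinAt_const (I := 𝓘(ℝ, ℝ)) (I' := 𝓡 (2 * n + 1)) y (Icc 0 1)
      t).congr_of_eventuallyEq (eventually_nhdsWithin_of_forall h) (h t ht)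
  have h3 : p.velocity t y = 0 :=
    congrArg (fun L : ℝ →L[ℝ] ContactModel n => L 1) (h1.symm.trans (h2.mfderivWithin hu))
  rw [ContactIsotopy.speed, h3]
  exact _root_.map_zero (α.form (p.map t y))

theorem IsCompactlySupported.exists_abs_speed_le {p : PathGe S} (hp : p.IsCompactlySupported) :
    ∃ C : ℝ, ∀ t ∈ Icc (0 : ℝ) 1, ∀ y, |p.speed t y| ≤ C := by
  obtain ⟨K, hK, h⟩ := hp
  obtain ⟨C, hC⟩ := (isCompact_Icc.prod hK).exists_bound_of_continuousOn
    p.continuous_speed.continuousOn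
  refine ⟨max C 0, fun t ht y => ?_⟩
  by_cases hy : y ∈ K
  · exact (hC (t, y) ⟨ht, hy⟩).trans (le_max_left _ _)
  · rw [p.speed_eq_zero_of_forall_map_eq (fun τ hτ => h τ hτ y hy) ht, abs_zero]
    exact le_max_right _ _

/-- Since Reeb maps have conformal factor `1`, the speed of `e_{mt} g_t⁻¹` is `m` plus that of
`g_t⁻¹`, which is bounded below. -/
theorem IsCompactlySupported.exists_succeq {g : PathGe S} (hg : g.IsCompactlySupported) :
    ∃ m : ℤ, Succeq (reebPath S m).toCover g.toCover := by
  obtain ⟨C, hC⟩ := hg.inv.exists_abs_speed_le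
  refine ⟨⌈C⌉, reebPath S ⌈C⌉, g, (reebPath S ⌈C⌉).mul g.inv, rfl, rfl, fun t x => ?_,
    _, rfl, fun t ht z => ?_⟩
  · rw [mul_map, inv_map, Contactomorphism.inv_apply]
  · rw [ContactIsotopy.hamiltonian_eq, speed_mul, speed_reebPath]
    refine mul_nonneg z.2.2.le ?_
    change 0 ≤ (⌈C⌉ : ℝ) + 1 * _
    have h1 := (abs_le.1 (hC t ht ((((reebPath S ⌈C⌉).mul g.inv).map t).inv z.1))).1
    have h2 := Int.le_ceil C
    linarith

end PathGe

end ContactGeometry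

end

theorem theorem2p6 {n : ℕ} {V : Type*} [TopologicalSpace V] [T2Space V]
    [SecondCountableTopology V] [ChartedSpace (ContactModel n) V]
    [IsManifold (𝓡 (2 * n + 1)) ∞ V]
    (α : ContactGeometry.ContactForm n V) (S : ContactGeometry.ReebCircleAction α)
    (A B : Set (ContactGeometry.Symplectization V))
    (hAB : ContactGeometry.StrongStableIntersection S A B)
    (hB : ∀ t : ℝ, MapsTo (S.contactFlow t).lift B B)
    (c : ℝ) (hc : 0 < c)
    (f : ContactGeometry.PathGe S) (hf : f.toCover ∈ ContactGeometry.coverGc S)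
    (hperiodic : ∀ t z, f.hamiltonian (t + 1) z = f.hamiltonian t z)
    (hF : ∀ t : ℝ, ∀ z ∈ B, c * (z.2 : ℝ) < f.hamiltonian t z) :
    c ≤ ContactGeometry.nuStar S (f.map 1) := by
  refine le_csInf ?_ ?_
  -- Nonemptiness matters: an infimum over the empty set would be `0`. The compactly supported
  -- representative of `f` supplies a lift.
  · obtain ⟨p, hp, hpf⟩ := hf
    exact ⟨_, p, hp, ContactGeometry.PathGe.map_one_eq_of_toCover_eq hpf, rfl⟩
  · rintro _ ⟨g, hg, hgf, rfl⟩
    have hle : ⌈c⌉ ≤ ContactGeometry.nuPlus g.toCover :=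
      -- The same concern arises for the integer infimum defining `ν_+`, whence the need for an `m`
      -- with `e^m ⪰ g`.
      le_csInf hg.exists_succeq fun m hm => Int.ceil_le.2
        (ContactGeometry.le_of_succeq_reebPath hAB hB hf hperiodic hF hg hgf hm)
    have hnu : ContactGeometry.nuPlus g.toCover ≤ ContactGeometry.nu g.toCover :=
      (le_abs_self _).trans (le_max_left _ _)
    exact (Int.le_ceil c).trans (by exact_mod_cast hle.trans hnu)
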